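/- There exist absolute constants $C_1, C_2, C_3 > 0$ such that the following holds. Let $n$ and $d$ be natural numbers, let $v \in \mathbb{R}^d$ be a fixed vector with $\|v\|_2 = 1$, and let $\delta \in (0, \tfrac12)$. Let $x_1, \dots, x_n$ be independent random vectors in $\mathbb{R}^d$, each with distribution $\mathcal{N}(0, I_d)$, and let the labels be $y_i = \operatorname{sign}(v^{\mathsf T} x_i)$ for $i = 1, \dots, n$. Assume that $$ n \ge C_1 \left(\log \tfrac1\delta\right)^2, \qquad d \le C_2\, n \log n, \qquad d \ge C_3\, n \log \tfrac1\delta. $$ Then, with probability at most $\delta$, support vector proliferation (SVP) occurs for the $\ell_2$-SVM on $(x_1,y_1),\dots,(x_n,y_n)$, that is, the optimization problem $$ \min_{w \in \mathbb{R}^d} \|w\|_2 \quad \text{such that} \quad y_i\, w^{\mathsf T} x_i \ge 1 \ \text{ for all } i \in \{1,\dots,n\} $$ has a solution $w$ and every example is a support vector for it: $y_i\, w^{\mathsf T} x_i = 1$ for all $i$. -/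

import Mathlib

open MeasureTheory ProbabilityTheory
open scoped RealInnerProductSpace

/-- Feasible points of the hard-margin SVM problem on the training data
`(x i, y i)`, `i < n`: all vectors `w` with `y i * ⟪w, x i⟫ ≥ 1` for every `i`. -/
def svmFeasible {n d : ℕ} (x : Fin n → EuclideanSpace ℝ (Fin d)) (y : Fin n → ℝ) :
    Set (EuclideanSpace ℝ (Fin d)) :=
  {w | ∀ i, 1 ≤ y i * ⟪w, x i⟫}

/-- `w` is a solution of the `ℓ₂`-SVM problem: it has minimal Euclidean norm among the
feasible vectors. -/
def IsSVMSolution {n d : ℕ} (x : Fin n → EuclideanSpace ℝ (Fin d)) (y : Fin n → ℝ)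
    (w : EuclideanSpace ℝ (Fin d)) : Prop :=
  w ∈ svmFeasible x y ∧ IsMinOn (fun u => ‖u‖) (svmFeasible x y) w

/-- The `i`-th example is a support vector for the separator `w`: it lies exactly on the
margin. -/
def IsSupportVector {n d : ℕ} (x : Fin n → EuclideanSpace ℝ (Fin d)) (y : Fin n → ℝ)
    (w : EuclideanSpace ℝ (Fin d)) (i : Fin n) : Prop :=
  y i * ⟪w, x i⟫ = 1

/-- Support vector proliferation for the `ℓ₂`-SVM: the SVM problem has a solution (it is
then unique, by strict convexity) and every training example is a support vector for it. -/
def SVPOccurs {n d : ℕ} (x : Fin n → EuclideanSpace ℝ (Fin d)) (y : Fin n → ℝ) : Prop :=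
  ∃ w, IsSVMSolution x y w ∧ ∀ i, IsSupportVector x y w i

/-! Write `w_S` for the minimal-norm separator of the points in `S` (`maxMargin`). If every point is
a support vector, then each leave-one-out separator has margin at most 1 at the omitted point
(`SVPOccurs.inner_maxMargin_erase_le`). The proof shows that some omitted point very likely violates
this.

Fix a set `A` of about `n^(1/4)` indices, with complement `B`. Three estimates are combined in
`gaussianSample_forall_inner_maxMargin_erase_le`.

Size: the margins of `w_B` add up to at least `|B|`, while the signed sum over `B` has squared norm
at most `8|B|d` except with probability `exp(-d/2)`. By Cauchy-Schwarz `‖w_B‖²` is at least of order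
`n/d`.

Anticoncentration: given `B`, the points of `A` are independent of `w_B`, and each has margin at
least 2 with probability at least `exp(-(64d/n+1))/6`. As `d ≤ n log n / 1024`, this is at least
`n^(-1/16)/18`, so among `n^(1/4)` trials one very likely succeeds.

Stability: passing from `w_B` to the leave-one-out separator of `i ∈ A` adds fewer than `|A|`
points. Each insertion raises the expected squared norm by `O(1/d)`, and strong convexity turns
growth of squared norm into squared distance (`lintegral_norm_maxMargin_sub_sq_le`). Since `x_i` is
independent of both separators, Markov's inequality bounds the probability that its margin drops by
1. The union over `A` costs `O(|A|²/d)`.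

The total is `O(n^(-3/16))`. The two bounds on `d` force `log(1/δ)` to be a small multiple of `log
n`, so this is below `δ`. -/

/-! ### Standard Gaussian vectors: marginals, exponential moments, projections. -/

section StdGaussian

variable {E : Type*} [NormedAddCommGroup E] [InnerProductSpace ℝ E] [FiniteDimensional ℝ E]
  [MeasurableSpace E] [BorelSpace E]

lemma map_inner_stdGaussian (u : E) :
    (stdGaussian E).map (fun y => ⟪u, y⟫) = gaussianReal 0 (‖u‖ ^ 2).toNNReal := by
  have h := IsGaussian.map_eq_gaussianReal (μ := stdGaussian E) (innerSL ℝ u)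
  rw [integral_strongDual_stdGaussian, variance_dual_stdGaussian, innerSL_apply_norm] at h
  exact h

lemma lintegral_inner_sq_stdGaussian (u : E) :
    ∫⁻ y, ENNReal.ofReal (⟪u, y⟫ ^ 2) ∂(stdGaussian E) = ENNReal.ofReal (‖u‖ ^ 2) := by
  have hL : MemLp (innerSL ℝ u) 2 (stdGaussian E) :=
    IsGaussian.memLp_dual _ _ _ (by simp)
  have h := variance_dual_stdGaussian (innerSL ℝ u)
  rw [variance_of_integral_eq_zero hL.1.aemeasurable (integral_strongDual_stdGaussian _),
    innerSL_apply_norm] at h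
  rw [← h, ofReal_integral_eq_lintegral_ofReal hL.integrable_sq
    (Filter.Eventually.of_forall fun _ => by positivity)]
  rfl

lemma stdGaussian_inner_eq_zero {v : E} (hv : v ≠ 0) :
    stdGaussian E {y | ⟪v, y⟫ = 0} = 0 := by
  have h0 : (‖v‖ ^ 2).toNNReal ≠ 0 := by
    have := norm_pos_iff.2 hv
    simp [hv]
  have := nullSingletonClass_gaussianReal (μ := 0) h0
  have h : (stdGaussian E).map (fun y => ⟪v, y⟫) {0} = 0 := by
    rw [map_inner_stdGaussian]; simp
  rwa [Measure.map_apply (by fun_prop) (by simp)] at h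

lemma integral_exp_sq_gaussianReal {a : ℝ} (ha : a < 1 / 2) :
    ∫ x, Real.exp (a * x ^ 2) ∂(gaussianReal 0 1) = (1 - 2 * a) ^ (-(1 / 2) : ℝ) := by
  have hp : 0 < 1 - 2 * a := by linarith
  rw [integral_gaussianReal_eq_integral_smul one_ne_zero]
  have h : ∀ x : ℝ, gaussianPDFReal 0 1 x • Real.exp (a * x ^ 2) =
      (√(2 * Real.pi))⁻¹ * Real.exp (-((1 - 2 * a) / 2) * x ^ 2) := by
    intro x
    rw [gaussianPDFReal, smul_eq_mul, mul_assoc, ← Real.exp_add]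
    simp only [NNReal.coe_one, mul_one]
    congr 2
    ring
  simp_rw [h]
  rw [integral_const_mul, integral_gaussian, ← Real.sqrt_inv, ← Real.sqrt_mul (by positivity),
    Real.rpow_neg hp.le, ← Real.sqrt_eq_rpow, ← Real.sqrt_inv]
  congr 1
  field_simp

lemma integral_exp_norm_sq_stdGaussian {a : ℝ} (ha : a < 1 / 2) :
    ∫ y, Real.exp (a * ‖y‖ ^ 2) ∂(stdGaussian E) =
      (1 - 2 * a) ^ (-(Module.finrank ℝ E / 2) : ℝ) := by
  have hp : 0 < 1 - 2 * a := by linarith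
  rw [stdGaussian, integral_map (Measurable.aemeasurable (by fun_prop))
    (Measurable.aestronglyMeasurable (by fun_prop))]
  have h : ∀ x : Fin (Module.finrank ℝ E) → ℝ,
      Real.exp (a * ‖∑ i, x i • stdOrthonormalBasis ℝ E i‖ ^ 2) =
        ∏ i, Real.exp (a * x i ^ 2) := by
    intro x
    rw [← Real.exp_sum, ← Finset.mul_sum,
      ← (stdOrthonormalBasis ℝ E).sum_sq_norm_inner_right]
    congr 2
    refine Finset.sum_congr rfl fun i _ => ?_
    rw [(stdOrthonormalBasis ℝ E).orthonormal.inner_right_fintype]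
    simp
  simp_rw [h]
  rw [integral_fintype_prod_eq_prod (f := fun _ x => Real.exp (a * x ^ 2))]
  simp_rw [integral_exp_sq_gaussianReal ha]
  rw [Finset.prod_const, Finset.card_univ, Fintype.card_fin, ← Real.rpow_mul_natCast hp.le]
  congr 1
  ring

lemma lintegral_exp_norm_sq_stdGaussian {a : ℝ} (ha : a < 1 / 2) :
    ∫⁻ y, ENNReal.ofReal (Real.exp (a * ‖y‖ ^ 2)) ∂(stdGaussian E) =
      ENNReal.ofReal ((1 - 2 * a) ^ (-(Module.finrank ℝ E / 2) : ℝ)) := by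
  have hp : 0 < 1 - 2 * a := by linarith
  have h := integral_exp_norm_sq_stdGaussian (E := E) ha
  rw [← h, ofReal_integral_eq_lintegral_ofReal]
  -- Integrability comes for free: otherwise the Bochner integral would be 0, but its value is
  -- positive.
  · by_contra hn
    rw [integral_undef hn] at h
    exact (Real.rpow_pos_of_pos hp _).ne h
  · exact Filter.Eventually.of_forall fun _ => by positivity

lemma map_orthogonalProjectionOnto_stdGaussian (V : Submodule ℝ E) :
    (stdGaussian E).map V.orthogonalProjectionOnto = stdGaussian V := by
  apply Measure.ext_of_charFun
  ext t
  rw [charFun_stdGaussian, charFun_apply, integral_map (Measurable.aemeasurable (by fun_prop))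
    (Measurable.aestronglyMeasurable (by fun_prop))]
  simp_rw [Submodule.inner_orthogonalProjectionOnto_eq_of_mem_right]
  rw [← charFun_apply, charFun_stdGaussian]
  simp

/-- The pair is jointly Gaussian, so vanishing covariance is enough. -/
lemma indepFun_inner_orthogonalProjectionOnto {V : Submodule ℝ E} {u : E} (hu : u ∈ Vᗮ) :
    IndepFun (fun y => ⟪u, y⟫) V.orthogonalProjectionOnto (stdGaussian E) := by
  have hG : HasGaussianLaw (fun y : E => (⟪u, y⟫, V.orthogonalProjectionOnto y))
      (stdGaussian E) := by
    have : HasGaussianLaw id (stdGaussian E) := ⟨by rw [Measure.map_id]; infer_instance⟩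
    exact this.map ((innerSL ℝ u).prod V.orthogonalProjectionOnto)
  refine hG.indepFun_of_covariance_inner fun a b => ?_
  have h1 : ∀ y : E, inner ℝ a ⟪u, y⟫ = ⟪a • u, y⟫ := fun y => by
    simp [real_inner_smul_left, mul_comm]
  have h2 : ∀ y : E, inner ℝ b (V.orthogonalProjectionOnto y) = ⟪(b : E), y⟫ := fun y => by
    rw [Submodule.inner_orthogonalProjectionOnto_eq_of_mem_left]
  simp_rw [h1, h2]
  rw [← covarianceBilin_apply_eq_cov IsGaussian.memLp_two_id, covarianceBilin_stdGaussian,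
    innerSL_apply_apply, real_inner_smul_left, Submodule.inner_left_of_mem_orthogonal b.2 hu]
  simp

end StdGaussian

/-! ### The inverse second moment of the norm, through the Laplace transform. -/

lemma lintegral_exp_neg_mul (s : ℝ) :
    (ENNReal.ofReal s)⁻¹ ≤ ∫⁻ t in Set.Ioi (0 : ℝ), ENNReal.ofReal (Real.exp (-t * s)) := by
  rcases le_or_gt s 0 with hs | hs
  · have h : ∫⁻ t in Set.Ioi (0 : ℝ), (1 : ENNReal) ≤
        ∫⁻ t in Set.Ioi (0 : ℝ), ENNReal.ofReal (Real.exp (-t * s)) := by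
      refine setLIntegral_mono' measurableSet_Ioi fun t ht => ?_
      rw [ENNReal.one_le_ofReal]
      exact Real.one_le_exp (by nlinarith [Set.mem_Ioi.1 ht])
    rw [setLIntegral_one, Real.volume_Ioi] at h
    rw [top_le_iff.1 h]
    exact le_top
  · have h := integral_exp_mul_Ioi (a := -s) (by linarith) 0
    have hi : IntegrableOn (fun t => Real.exp (-t * s)) (Set.Ioi 0) := by
      have := integrableOn_exp_mul_Ioi (a := -s) (by linarith) 0
      refine this.congr_fun (fun t _ => ?_) measurableSet_Ioi
      simp only; ring_nf
    rw [← ofReal_integral_eq_lintegral_ofReal hi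
      (Filter.Eventually.of_forall fun _ => by positivity), ← ENNReal.ofReal_inv_of_pos hs]
    refine ENNReal.ofReal_le_ofReal (le_of_eq ?_)
    rw [← one_div]
    have e : ∀ t : ℝ, Real.exp (-t * s) = Real.exp (-s * t) := fun t => by ring_nf
    simp_rw [e, h]
    simp

lemma lintegral_one_add_two_mul_rpow {r : ℝ} (hr : 1 < r) :
    ∫⁻ t in Set.Ioi (0 : ℝ), ENNReal.ofReal ((1 + 2 * t) ^ (-r)) =
      ENNReal.ofReal (1 / (2 * (r - 1))) := by
  have hd : ∀ t ∈ Set.Ici (0 : ℝ), HasDerivAt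
      (fun t : ℝ => -(1 + 2 * t) ^ (1 - r) / (2 * (r - 1))) ((1 + 2 * t) ^ (-r)) t := by
    intro t ht
    have ht : (0 : ℝ) ≤ t := ht
    have h1 : HasDerivAt (fun t : ℝ => 1 + 2 * t) 2 t := by
      simpa using ((hasDerivAt_id t).const_mul 2).const_add 1
    have h2 := ((h1.rpow_const (p := 1 - r) (Or.inl (by positivity))).neg).div_const
      (2 * (r - 1))
    have hr0 : r - 1 ≠ 0 := by linarith
    have e : (1 + 2 * t) ^ (-r) = -(2 * (1 - r) * (1 + 2 * t) ^ (1 - r - 1)) / (2 * (r - 1)) := by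
      rw [show 1 - r - 1 = -r by ring]
      field_simp
      ring
    rw [e]
    exact h2
  have hlim : Filter.Tendsto (fun t : ℝ => -(1 + 2 * t) ^ (1 - r) / (2 * (r - 1)))
      Filter.atTop (nhds 0) := by
    have h1 : Filter.Tendsto (fun t : ℝ => 1 + 2 * t) Filter.atTop Filter.atTop :=
      Filter.tendsto_atTop_add_const_left _ _
        (Filter.tendsto_id.const_mul_atTop (by norm_num))
    have h2 := (tendsto_rpow_neg_atTop (y := r - 1) (by linarith)).comp h1
    have h3 := (h2.neg).div_const (2 * (r - 1))
    simpa [Function.comp_def] using h3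
  have hnn : ∀ t ∈ Set.Ioi (0 : ℝ), 0 ≤ (1 + 2 * t) ^ (-r) := fun t ht => by
    have : (0 : ℝ) < t := ht
    positivity
  have hI := integral_Ioi_of_hasDerivAt_of_nonneg' hd hnn hlim
  have hi := integrableOn_Ioi_deriv_of_nonneg' hd hnn hlim
  rw [← ofReal_integral_eq_lintegral_ofReal hi (by
    filter_upwards [ae_restrict_mem measurableSet_Ioi] with t ht using hnn t ht), hI]
  congr 1
  simp only [mul_zero, add_zero, Real.one_rpow]
  ring

section StdGaussian

variable {E : Type*} [NormedAddCommGroup E] [InnerProductSpace ℝ E] [FiniteDimensional ℝ E]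
  [MeasurableSpace E] [BorelSpace E]

/-- Write `1/s` as the integral of `exp(-ts)` over `t > 0` and exchange integrals; the exponential
moment `(1+2t)^(-D/2)` is integrable in `t` because `D > 2`. -/
lemma lintegral_inv_norm_sq_stdGaussian (hD : 2 < Module.finrank ℝ E) :
    ∫⁻ y, (ENNReal.ofReal (‖y‖ ^ 2))⁻¹ ∂(stdGaussian E) ≤
      ENNReal.ofReal (1 / (Module.finrank ℝ E - 2)) := by
  have hD' : (2 : ℝ) < Module.finrank ℝ E := by exact_mod_cast hD
  calc ∫⁻ y, (ENNReal.ofReal (‖y‖ ^ 2))⁻¹ ∂(stdGaussian E)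
      ≤ ∫⁻ y, (∫⁻ t in Set.Ioi (0 : ℝ), ENNReal.ofReal (Real.exp (-t * ‖y‖ ^ 2)))
          ∂(stdGaussian E) := lintegral_mono fun y => lintegral_exp_neg_mul _
    _ = ∫⁻ t in Set.Ioi (0 : ℝ), (∫⁻ y, ENNReal.ofReal (Real.exp (-t * ‖y‖ ^ 2))
          ∂(stdGaussian E)) := by
        rw [lintegral_lintegral_swap]
        exact Measurable.aemeasurable (by fun_prop)
    _ = ∫⁻ t in Set.Ioi (0 : ℝ),
          ENNReal.ofReal ((1 + 2 * t) ^ (-(Module.finrank ℝ E / 2) : ℝ)) := by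
        refine setLIntegral_congr_fun measurableSet_Ioi fun t ht => ?_
        have ht : (0 : ℝ) < t := ht
        rw [lintegral_exp_norm_sq_stdGaussian (by linarith)]
        congr 2
        ring
    _ = ENNReal.ofReal (1 / (Module.finrank ℝ E - 2)) := by
        rw [lintegral_one_add_two_mul_rpow (by linarith)]
        congr 2
        ring

/-- The integrand is the bound on the cost of inserting a point `y`, with `u` the current separator
and `V` the orthogonal complement of the old points. Independence factors the expectation. -/
lemma lintegral_inner_mul_inv_norm_sq_projection {V : Submodule ℝ E} {u : E} (hu : u ∈ Vᗮ)
    (hD : 2 < Module.finrank ℝ V) :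
    ∫⁻ y, ENNReal.ofReal (2 * (1 + ⟪u, y⟫ ^ 2)) *
        (ENNReal.ofReal (‖V.orthogonalProjectionOnto y‖ ^ 2))⁻¹ ∂(stdGaussian E) ≤
      ENNReal.ofReal (2 / (Module.finrank ℝ V - 2)) * ENNReal.ofReal (1 + ‖u‖ ^ 2) := by
  have hD' : (2 : ℝ) < Module.finrank ℝ V := by exact_mod_cast hD
  have hind := (indepFun_inner_orthogonalProjectionOnto hu).comp
    (φ := fun s : ℝ => ENNReal.ofReal (2 * (1 + s ^ 2)))
    (ψ := fun z : V => (ENNReal.ofReal (‖z‖ ^ 2))⁻¹) (by fun_prop) (by fun_prop)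
  have h1 := lintegral_mul_eq_lintegral_mul_lintegral_of_indepFun (by fun_prop) (by fun_prop) hind
  have h2 : ∫⁻ y, ENNReal.ofReal (2 * (1 + ⟪u, y⟫ ^ 2)) ∂(stdGaussian E) =
      ENNReal.ofReal (2 * (1 + ‖u‖ ^ 2)) := by
    have : ∀ y : E, ENNReal.ofReal (2 * (1 + ⟪u, y⟫ ^ 2)) =
        ENNReal.ofReal 2 * (1 + ENNReal.ofReal (⟪u, y⟫ ^ 2)) := fun y => by
      rw [ENNReal.ofReal_mul (by norm_num), ENNReal.ofReal_add (by norm_num) (by positivity)]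
      simp
    simp_rw [this]
    rw [lintegral_const_mul _ (by fun_prop), lintegral_add_left (by fun_prop),
      lintegral_inner_sq_stdGaussian, ENNReal.ofReal_mul (by norm_num),
      ENNReal.ofReal_add (by norm_num) (by positivity)]
    simp
  have h3 : ∫⁻ y, (ENNReal.ofReal (‖V.orthogonalProjectionOnto y‖ ^ 2))⁻¹ ∂(stdGaussian E) =
      ∫⁻ z, (ENNReal.ofReal (‖z‖ ^ 2))⁻¹ ∂(stdGaussian V) := by
    rw [← map_orthogonalProjectionOnto_stdGaussian, lintegral_map (by fun_prop) (by fun_prop)]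
  simp only [Pi.mul_apply, Function.comp_apply] at h1
  rw [h1, h2, h3]
  refine (mul_le_mul_right (lintegral_inv_norm_sq_stdGaussian hD) _).trans (le_of_eq ?_)
  have h4 : 0 < (Module.finrank ℝ V : ℝ) - 2 := by linarith
  rw [← ENNReal.ofReal_mul (by positivity), ← ENNReal.ofReal_mul (by positivity)]
  congr 1
  ring

end StdGaussian

/-! ### Lower tail bounds for Gaussian margins, before and after fixing the sign. -/

lemma gaussianReal_Ici_ge (t : ℝ) :
    ENNReal.ofReal (Real.exp (-(t ^ 2 + 1)) / 3) ≤ gaussianReal 0 1 (Set.Ici t) := by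
  have h1 : ENNReal.ofReal (Real.exp (-(t ^ 2 + 1)) / 3) * volume (Set.Icc t (t + 1)) ≤
      ∫⁻ x in Set.Icc t (t + 1), gaussianPDF 0 1 x := by
    rw [← setLIntegral_const]
    refine setLIntegral_mono' measurableSet_Icc fun x hx => ?_
    rw [gaussianPDF]
    refine ENNReal.ofReal_le_ofReal ?_
    rw [gaussianPDFReal]
    simp only [NNReal.coe_one, mul_one, sub_zero]
    have h3 : (1 : ℝ) / 3 ≤ (√(2 * Real.pi))⁻¹ := by
      rw [one_div]
      refine inv_anti₀ (by positivity) ?_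
      rw [Real.sqrt_le_left (by norm_num)]
      nlinarith [Real.pi_lt_d2]
    have h4 : Real.exp (-(t ^ 2 + 1)) ≤ Real.exp (-x ^ 2 / 2) := by
      refine Real.exp_le_exp.2 ?_
      -- At the endpoint, `(t+1)²/2 ≤ t² + 1` is `(t-1)² ≥ 0`.
      nlinarith [hx.1, hx.2, sq_nonneg (t - 1)]
    rw [div_eq_mul_one_div, mul_comm]
    gcongr
  rw [Real.volume_Icc, add_sub_cancel_left, ENNReal.ofReal_one, mul_one] at h1
  rw [gaussianReal_apply _ one_ne_zero]
  exact h1.trans (lintegral_mono_set Set.Icc_subset_Ici_self)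

section StdGaussian

variable {E : Type*} [NormedAddCommGroup E] [InnerProductSpace ℝ E]

/-- The vector `y`, with its sign flipped so that its inner product with `v` is nonnegative. -/
noncomputable def signed (v y : E) : E := if ⟪v, y⟫ < 0 then -y else y

lemma inner_signed_nonneg (v y : E) : 0 ≤ ⟪v, signed v y⟫ := by
  unfold signed; split_ifs with h
  · rw [inner_neg_right]; linarith
  · exact not_lt.1 h

lemma inner_signed_pos {v y : E} (h : ⟪v, y⟫ ≠ 0) : 0 < ⟪v, signed v y⟫ := by
  refine (inner_signed_nonneg v y).lt_of_ne' ?_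
  unfold signed; split_ifs <;> simp [h]

lemma inner_signed_sq (v u y : E) : ⟪u, signed v y⟫ ^ 2 = ⟪u, y⟫ ^ 2 := by
  unfold signed; split_ifs <;> simp

lemma signed_mem_iff {v y : E} {V : Submodule ℝ E} : signed v y ∈ V ↔ y ∈ V := by
  unfold signed; split_ifs <;> simp

lemma signed_eq_sign_smul {v y : E} (h : ⟪v, y⟫ ≠ 0) :
    signed v y = Real.sign ⟪v, y⟫ • y := by
  unfold signed; split_ifs with h1
  · rw [Real.sign_of_neg h1]; simp
  · rw [Real.sign_of_pos (lt_of_le_of_ne (not_lt.1 h1) (Ne.symm h))]; simp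

/-- Reflection in the line of `v` keeps `⟪v, y⟫`. When this is negative, the signed reflected vector
is `y - 2⟪v, y⟫v`, whose inner product with `u` is no smaller than that of `y`. As the reflection
preserves the Gaussian law, fixing signs costs at most a factor 2 in the tail bound. -/
lemma le_inner_signed_or {v u y : E} (hv : ‖v‖ = 1) (huv : 0 ≤ ⟪u, v⟫) {t : ℝ}
    (h : t ≤ ⟪u, y⟫) :
    t ≤ ⟪u, signed v y⟫ ∨ t ≤ ⟪u, signed v ((ℝ ∙ v).reflection y)⟫ := by
  by_cases h1 : ⟪v, y⟫ < 0
  · right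
    have hr : (ℝ ∙ v).reflection y = (2 * ⟪v, y⟫) • v - y := by
      rw [Submodule.reflection_singleton_apply]
      simp [hv, two_smul, add_smul, two_mul]
    have h2 : ⟪v, (ℝ ∙ v).reflection y⟫ < 0 := by
      rw [hr, inner_sub_right, real_inner_smul_right, real_inner_self_eq_norm_sq, hv]
      linarith
    rw [signed, if_pos h2, hr, inner_neg_right, inner_sub_right, real_inner_smul_right]
    nlinarith
  · left
    rwa [signed, if_neg h1]

variable [MeasurableSpace E] [BorelSpace E]

lemma measurable_signed [SecondCountableTopology E] (v : E) : Measurable (signed v) :=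
  Measurable.ite (measurableSet_lt (by fun_prop) measurable_const) (by fun_prop) measurable_id

variable [FiniteDimensional ℝ E]

lemma stdGaussian_le_inner_ge {u : E} (hu : u ≠ 0) (t : ℝ) :
    ENNReal.ofReal (Real.exp (-(t ^ 2 / ‖u‖ ^ 2 + 1)) / 3) ≤
      stdGaussian E {y | t ≤ ⟪u, y⟫} := by
  have hu' : 0 < ‖u‖ := norm_pos_iff.2 hu
  have h := map_inner_stdGaussian (‖u‖⁻¹ • u)
  have hn : ‖‖u‖⁻¹ • u‖ = 1 := by
    rw [norm_smul, norm_inv, norm_norm, inv_mul_cancel₀ hu'.ne']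
  rw [hn, one_pow, Real.toNNReal_one] at h
  have h2 := gaussianReal_Ici_ge (t / ‖u‖)
  rw [← h, Measure.map_apply (by fun_prop) measurableSet_Ici, div_pow] at h2
  refine h2.trans (measure_mono fun y hy => ?_)
  have hy : t / ‖u‖ ≤ ⟪‖u‖⁻¹ • u, y⟫ := hy
  rw [real_inner_smul_left, div_le_iff₀ hu', mul_comm, ← mul_assoc, mul_inv_cancel₀ hu'.ne',
    one_mul] at hy
  exact hy

lemma stdGaussian_le_inner_signed_ge {v u : E} (hv : ‖v‖ = 1) (hu : u ≠ 0) (huv : 0 ≤ ⟪u, v⟫)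
    (t : ℝ) :
    ENNReal.ofReal (Real.exp (-(t ^ 2 / ‖u‖ ^ 2 + 1)) / 6) ≤
      stdGaussian E {y | t ≤ ⟪u, signed v y⟫} := by
  have hms := measurable_signed v
  have hm : MeasurableSet {y | t ≤ ⟪u, signed v y⟫} :=
    measurableSet_le measurable_const (by fun_prop)
  have h1 : stdGaussian E {y | t ≤ ⟪u, y⟫} ≤
      stdGaussian E {y | t ≤ ⟪u, signed v y⟫} + stdGaussian E {y | t ≤ ⟪u, signed v y⟫} := by
    calc stdGaussian E {y | t ≤ ⟪u, y⟫} ≤ stdGaussian E ({y | t ≤ ⟪u, signed v y⟫} ∪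
          (ℝ ∙ v).reflection ⁻¹' {y | t ≤ ⟪u, signed v y⟫}) :=
        measure_mono fun y hy => le_inner_signed_or hv huv hy
      _ ≤ _ := measure_union_le _ _
      _ = _ := by
        rw [← Measure.map_apply (by fun_prop) hm, stdGaussian_map]
  have h2 := (stdGaussian_le_inner_ge hu t).trans h1
  rw [← two_mul, ← ENNReal.div_le_iff' (by simp) (by simp)] at h2
  refine le_trans (le_of_eq ?_) h2
  rw [show (2 : ENNReal) = ENNReal.ofReal 2 by simp, ← ENNReal.ofReal_div_of_pos (by norm_num)]
  congr 1
  ring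

/-! ### Concentration of signed sums of Gaussian vectors. -/

lemma map_sum_smul_pi_stdGaussian {ι : Type*} [Fintype ι] (c : ι → ℝ) :
    (Measure.pi fun _ : ι => stdGaussian E).map (fun x => ∑ i, c i • x i) =
      (stdGaussian E).map (fun y => √(∑ i, c i ^ 2) • y) := by
  have h1 : (Measure.pi fun _ : ι => stdGaussian E).map (fun x => ∑ i, c i • x i) =
      (Measure.pi fun i : ι => (stdGaussian E).map (fun y => c i • y)).map
        (fun x => ∑ i, x i) := by
    rw [← Measure.pi_map_pi (fun i => by fun_prop), Measure.map_map (by fun_prop) (by fun_prop)]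
    rfl
  have : ∀ i, IsProbabilityMeasure ((stdGaussian E).map (fun y => c i • y)) := fun i =>
    Measure.isProbabilityMeasure_map (by fun_prop)
  apply Measure.ext_of_charFun
  ext t
  rw [h1, charFun_map_sum_pi_eq_prod, Finset.prod_apply, charFun_map_smul, charFun_stdGaussian]
  simp_rw [charFun_map_smul, charFun_stdGaussian]
  rw [← Complex.exp_sum]
  congr 1
  simp only [norm_smul, mul_pow, Complex.ofReal_mul, ← Complex.ofReal_pow,
    Real.norm_eq_abs, sq_abs]
  norm_cast
  rw [Real.sq_sqrt (Finset.sum_nonneg fun i _ => sq_nonneg _), Finset.sum_mul,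
    ← Finset.sum_neg_distrib]
  norm_cast
  rw [Finset.sum_div]

/-- Chernoff bound with exponent `1/4`: the exponential moment is `2^(D/2) ≤ exp(D/2)`, against the
threshold `exp(2D)`. -/
lemma stdGaussian_norm_sq_ge_le :
    stdGaussian E {y | 8 * (Module.finrank ℝ E : ℝ) ≤ ‖y‖ ^ 2} ≤
      ENNReal.ofReal (Real.exp (-(3 / 2) * Module.finrank ℝ E)) := by
  set D : ℝ := ((Module.finrank ℝ E : ℕ) : ℝ) with hD
  have hD0 : 0 ≤ D := by positivity
  have h := mul_meas_ge_le_lintegral (μ := stdGaussian E)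
    (f := fun y => ENNReal.ofReal (Real.exp (1 / 4 * ‖y‖ ^ 2))) (by fun_prop)
    (ENNReal.ofReal (Real.exp (2 * D)))
  rw [lintegral_exp_norm_sq_stdGaussian (by norm_num), ← hD] at h
  have h2 : ((1 - 2 * (1 / 4) : ℝ)) ^ (-(D / 2)) ≤ Real.exp (D / 2) := by
    rw [show (1 - 2 * (1 / 4) : ℝ) = 2⁻¹ by norm_num, Real.rpow_neg (by norm_num),
      Real.inv_rpow (by norm_num), inv_inv, ← Real.exp_one_rpow]
    gcongr
    nlinarith [Real.add_one_le_exp 1]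
  have h3 : {y : E | 8 * D ≤ ‖y‖ ^ 2} ⊆ {y : E | ENNReal.ofReal (Real.exp (2 * D)) ≤
      ENNReal.ofReal (Real.exp (1 / 4 * ‖y‖ ^ 2))} := fun y hy => by
    refine ENNReal.ofReal_le_ofReal (Real.exp_le_exp.2 ?_)
    have hy : 8 * D ≤ ‖y‖ ^ 2 := hy
    linarith
  have h4 := (mul_le_mul_right (measure_mono h3) _).trans (h.trans (ENNReal.ofReal_le_ofReal h2))
  rw [mul_comm, ← ENNReal.le_div_iff_mul_le (by left; simp [Real.exp_pos]) (by left; simp),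
    ← ENNReal.ofReal_div_of_pos (Real.exp_pos _), ← Real.exp_sub] at h4
  refine h4.trans (le_of_eq ?_)
  congr 2
  ring

lemma pi_stdGaussian_norm_sq_sum_ge_le {ι : Type*} [Fintype ι] (c : ι → ℝ) {b : ℝ}
    (hb : ∑ i, c i ^ 2 ≤ b) :
    Measure.pi (fun _ : ι => stdGaussian E)
        {x | 8 * b * (Module.finrank ℝ E : ℝ) < ‖∑ i, c i • x i‖ ^ 2} ≤
      ENNReal.ofReal (Real.exp (-(3 / 2) * Module.finrank ℝ E)) := by
  have hm : MeasurableSet {z : E | 8 * b * (Module.finrank ℝ E : ℝ) < ‖z‖ ^ 2} :=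
    measurableSet_lt measurable_const (by fun_prop)
  have h1 := Measure.map_apply (μ := Measure.pi (fun _ : ι => stdGaussian E))
    (f := fun x => ∑ i, c i • x i) (by fun_prop) hm
  rw [map_sum_smul_pi_stdGaussian, Measure.map_apply (by fun_prop) hm] at h1
  have h0 : 0 ≤ ∑ i, c i ^ 2 := Finset.sum_nonneg fun i _ => sq_nonneg _
  refine h1.symm.le.trans ((measure_mono fun y hy => ?_).trans stdGaussian_norm_sq_ge_le)
  have hy : 8 * b * (Module.finrank ℝ E : ℝ) < ‖√(∑ i, c i ^ 2) • y‖ ^ 2 := hy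
  rw [norm_smul, mul_pow, Real.norm_eq_abs, sq_abs, Real.sq_sqrt h0] at hy
  have hb0 := h0.trans hb
  by_contra hc
  have hc : ‖y‖ ^ 2 < 8 * (Module.finrank ℝ E : ℝ) := not_le.1 hc
  nlinarith [mul_le_mul_of_nonneg_right hb (sq_nonneg ‖y‖)]

/-- The signs depend on the data, so a union bound runs over all sign patterns. There are `2^|ι| ≤
exp D` of them, each failing with probability at most `exp(-3D/2)`. -/
lemma pi_stdGaussian_norm_sq_sum_signed_le {ι : Type*} [Fintype ι] (v : E) (S : Finset ι)
    (hcard : Fintype.card ι ≤ Module.finrank ℝ E) :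
    Measure.pi (fun _ : ι => stdGaussian E)
        {x | 8 * (S.card : ℝ) * (Module.finrank ℝ E : ℝ) < ‖∑ i ∈ S, signed v (x i)‖ ^ 2} ≤
      ENNReal.ofReal (Real.exp (-(1 / 2) * Module.finrank ℝ E)) := by
  classical
  set D : ℝ := ((Module.finrank ℝ E : ℕ) : ℝ) with hD
  let c : (ι → Bool) → ι → ℝ := fun ε i => if i ∈ S then (if ε i then -1 else 1) else 0
  have hc : ∀ ε, ∑ i, c ε i ^ 2 ≤ S.card := fun ε => by
    rw [Finset.card_eq_sum_ones, Nat.cast_sum, ← Finset.sum_filter_add_sum_filter_not _ (· ∈ S)]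
    have e1 : ∑ i with i ∉ S, c ε i ^ 2 = 0 := Finset.sum_eq_zero fun i hi => by
      simp [c, (Finset.mem_filter.1 hi).2]
    rw [e1, add_zero, Finset.filter_mem_eq_inter, Finset.univ_inter]
    refine Finset.sum_le_sum fun i hi => ?_
    simp only [c, hi, if_true]
    split_ifs <;> simp
  have hsub : {x : ι → E | 8 * (S.card : ℝ) * D < ‖∑ i ∈ S, signed v (x i)‖ ^ 2} ⊆
      ⋃ ε : ι → Bool, {x | 8 * (S.card : ℝ) * D < ‖∑ i, c ε i • x i‖ ^ 2} := fun x hx => by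
    refine Set.mem_iUnion.2 ⟨fun i => decide (⟪v, x i⟫ < 0), ?_⟩
    have e : ∑ i ∈ S, signed v (x i) =
        ∑ i, c (fun i => decide (⟪v, x i⟫ < 0)) i • x i := by
      rw [← Finset.sum_subset (Finset.subset_univ S)]
      · refine Finset.sum_congr rfl fun i hi => ?_
        simp only [c, hi, if_true, signed, decide_eq_true_eq]
        split_ifs <;> simp
      · intro i _ hi
        simp [c, hi]
    have hx : 8 * (S.card : ℝ) * D < ‖∑ i ∈ S, signed v (x i)‖ ^ 2 := hx
    rwa [e] at hx
  refine (measure_mono hsub).trans ((measure_iUnion_fintype_le _ _).trans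
    ((Finset.sum_le_sum fun ε _ => pi_stdGaussian_norm_sq_sum_ge_le (c ε) (hc ε)).trans ?_))
  rw [Finset.sum_const, Finset.card_univ, Fintype.card_fun, Fintype.card_bool, ← hD,
    nsmul_eq_mul, Nat.cast_pow, Nat.cast_ofNat, show (2 : ENNReal) = ENNReal.ofReal 2 by simp,
    ← ENNReal.ofReal_pow (by norm_num), ← ENNReal.ofReal_mul (by positivity)]
  refine ENNReal.ofReal_le_ofReal ?_
  have h2 : (2 : ℝ) ^ Fintype.card ι ≤ Real.exp D := by
    calc (2 : ℝ) ^ Fintype.card ι ≤ Real.exp 1 ^ Module.finrank ℝ E := by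
          refine (pow_le_pow_right₀ (by norm_num) hcard).trans ?_
          gcongr
          linarith [Real.add_one_le_exp 1]
      _ = Real.exp D := by rw [← Real.exp_nat_mul, mul_one]
  calc _ ≤ Real.exp D * Real.exp (-(3 / 2) * D) := by gcongr
    _ = _ := by rw [← Real.exp_add]; congr 1; ring

end StdGaussian

/-! ### Deterministic geometry of maximum margin separators. -/

section MaxMargin

variable {E : Type*} [NormedAddCommGroup E] [InnerProductSpace ℝ E] {ι : Type*}

/-- Vectors that separate the points `x i`, `i ∈ S`, labelled by the sign of `⟪v, x i⟫`, with
margin at least one. -/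
def marginSet (v : E) (S : Finset ι) (x : ι → E) : Set E :=
  {w | ∀ i ∈ S, 1 ≤ ⟪w, signed v (x i)⟫}

lemma marginSet_anti (v : E) {S T : Finset ι} (h : S ⊆ T) (x : ι → E) :
    marginSet v T x ⊆ marginSet v S x := fun _ hw i hi => hw i (h hi)

lemma marginSet_congr (v : E) {S : Finset ι} {x x' : ι → E} (h : ∀ i ∈ S, x i = x' i) :
    marginSet v S x = marginSet v S x' := by
  ext w
  exact forall₂_congr fun i hi => by rw [h i hi]

lemma convex_marginSet (v : E) (S : Finset ι) (x : ι → E) : Convex ℝ (marginSet v S x) := by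
  intro w hw w' hw' a b ha hb hab i hi
  rw [inner_add_left, real_inner_smul_left, real_inner_smul_left]
  nlinarith [hw i hi, hw' i hi]

lemma isClosed_marginSet (v : E) (S : Finset ι) (x : ι → E) : IsClosed (marginSet v S x) := by
  have : marginSet v S x = ⋂ i ∈ S, {w | 1 ≤ ⟪w, signed v (x i)⟫} := by
    ext; simp [marginSet]
  rw [this]
  exact isClosed_biInter fun i _ => isClosed_le continuous_const (by fun_prop)

/-- If no `x i` is orthogonal to `v`, then a large multiple of `v` separates with margin. -/
lemma marginSet_nonempty {v : E} {S : Finset ι} {x : ι → E} (h : ∀ i ∈ S, ⟪v, x i⟫ ≠ 0) :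
    (marginSet v S x).Nonempty := by
  refine ⟨(∑ i ∈ S, ⟪v, signed v (x i)⟫⁻¹) • v, fun i hi => ?_⟩
  have hp := inner_signed_pos (h i hi)
  rw [real_inner_smul_left, ← div_le_iff₀ hp, one_div]
  exact Finset.single_le_sum (f := fun i => ⟪v, signed v (x i)⟫⁻¹)
    (fun j _ => inv_nonneg.2 (inner_signed_nonneg v (x j))) hi

variable [CompleteSpace E]

/-- The projection of 0 onto a closed convex set makes an obtuse angle with every feasible
direction. This quantitative form of minimality gives uniqueness, stability and measurability. -/
lemma exists_norm_minimal_marginSet {v : E} {S : Finset ι} {x : ι → E}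
    (h : ∀ i ∈ S, ⟪v, x i⟫ ≠ 0) :
    ∃ w ∈ marginSet v S x, ∀ w' ∈ marginSet v S x, ‖w‖ ^ 2 + ‖w' - w‖ ^ 2 ≤ ‖w'‖ ^ 2 := by
  obtain ⟨w, hw, he⟩ := exists_norm_eq_iInf_of_complete_convex (marginSet_nonempty h)
    (isClosed_marginSet v S x).isComplete (convex_marginSet v S x) 0
  refine ⟨w, hw, fun w' hw' => ?_⟩
  have h1 := (norm_eq_iInf_iff_real_inner_le_zero (convex_marginSet v S x) hw).1 he w' hw'
  have h2 := norm_add_sq_real w (w' - w)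
  rw [add_sub_cancel] at h2
  rw [zero_sub, inner_neg_left] at h1
  linarith

open Classical in
/-- The separator of minimal norm for the points `x i`, `i ∈ S`; it is `0` if one of these points
is orthogonal to `v`. -/
noncomputable def maxMargin (v : E) (S : Finset ι) (x : ι → E) : E :=
  if h : ∀ i ∈ S, ⟪v, x i⟫ ≠ 0 then (exists_norm_minimal_marginSet h).choose else 0

variable {v : E} {S T : Finset ι} {x : ι → E}

lemma maxMargin_mem (h : ∀ i ∈ S, ⟪v, x i⟫ ≠ 0) : maxMargin v S x ∈ marginSet v S x := by
  rw [maxMargin, dif_pos h]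
  exact (exists_norm_minimal_marginSet h).choose_spec.1

lemma maxMargin_norm_sq_add_le (h : ∀ i ∈ S, ⟪v, x i⟫ ≠ 0) {w : E}
    (hw : w ∈ marginSet v S x) :
    ‖maxMargin v S x‖ ^ 2 + ‖w - maxMargin v S x‖ ^ 2 ≤ ‖w‖ ^ 2 := by
  rw [maxMargin, dif_pos h]
  exact (exists_norm_minimal_marginSet h).choose_spec.2 w hw

lemma eq_maxMargin (h : ∀ i ∈ S, ⟪v, x i⟫ ≠ 0) {w : E} (hw : w ∈ marginSet v S x)
    (hle : ‖w‖ ≤ ‖maxMargin v S x‖) : w = maxMargin v S x := by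
  have h1 := maxMargin_norm_sq_add_le h hw
  have h2 : ‖w‖ ^ 2 ≤ ‖maxMargin v S x‖ ^ 2 := by gcongr
  have h3 : ‖w - maxMargin v S x‖ ^ 2 = 0 := le_antisymm (by linarith) (sq_nonneg _)
  exact sub_eq_zero.1 (norm_eq_zero.1 (pow_eq_zero_iff two_ne_zero |>.1 h3))

lemma maxMargin_norm_le (h : ∀ i ∈ S, ⟪v, x i⟫ ≠ 0) {w : E} (hw : w ∈ marginSet v S x) :
    ‖maxMargin v S x‖ ≤ ‖w‖ := by
  have h1 := maxMargin_norm_sq_add_le h hw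
  refine (pow_le_pow_iff_left₀ (norm_nonneg _) (norm_nonneg _) two_ne_zero).1 ?_
  linarith [sq_nonneg ‖w - maxMargin v S x‖]

lemma maxMargin_congr {x' : ι → E} (hx : ∀ i ∈ S, x i = x' i) :
    maxMargin v S x = maxMargin v S x' := by
  by_cases h : ∀ i ∈ S, ⟪v, x i⟫ ≠ 0
  · have h' : ∀ i ∈ S, ⟪v, x' i⟫ ≠ 0 := fun i hi => hx i hi ▸ h i hi
    refine eq_maxMargin h' (marginSet_congr v hx ▸ maxMargin_mem h) ?_
    exact maxMargin_norm_le h (marginSet_congr v hx ▸ maxMargin_mem h')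
  · have h' : ¬ ∀ i ∈ S, ⟪v, x' i⟫ ≠ 0 := fun h' => h fun i hi => hx i hi ▸ h' i hi
    rw [maxMargin, maxMargin, dif_neg h, dif_neg h']

lemma maxMargin_update [DecidableEq ι] {j : ι} (hj : j ∉ S) (y : E) :
    maxMargin v S (Function.update x j y) = maxMargin v S x :=
  maxMargin_congr fun _ hi => Function.update_of_ne (ne_of_mem_of_not_mem hi hj) _ _

lemma maxMargin_empty : maxMargin v ∅ x = 0 := by
  have h : ∀ i ∈ (∅ : Finset ι), ⟪v, x i⟫ ≠ 0 := by simp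
  have := maxMargin_norm_le h (w := 0) (by simp [marginSet])
  simpa using this

lemma maxMargin_sub_norm_sq_le (hST : S ⊆ T) (h : ∀ i ∈ T, ⟪v, x i⟫ ≠ 0) :
    ‖maxMargin v T x - maxMargin v S x‖ ^ 2 ≤
      ‖maxMargin v T x‖ ^ 2 - ‖maxMargin v S x‖ ^ 2 := by
  have := maxMargin_norm_sq_add_le (fun i hi => h i (hST hi))
    (marginSet_anti v hST x (maxMargin_mem h))
  linarith

/-- Removing a negative component along `v` only increases the margins and shortens the vector. -/
lemma inner_maxMargin_nonneg (hv : ‖v‖ = 1) : 0 ≤ ⟪maxMargin v S x, v⟫ := by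
  by_cases h : ∀ i ∈ S, ⟪v, x i⟫ ≠ 0
  · set w := maxMargin v S x with hw
    by_contra hc
    rw [not_le] at hc
    have hm : w - ⟪w, v⟫ • v ∈ marginSet v S x := fun i hi => by
      rw [inner_sub_left, real_inner_smul_left]
      nlinarith [maxMargin_mem h i hi, inner_signed_nonneg v (x i)]
    have h1 := maxMargin_norm_sq_add_le h hm
    rw [← hw, sub_sub_cancel_left, norm_sub_sq_real, real_inner_smul_right, norm_neg, norm_smul,
      hv, Real.norm_eq_abs, mul_one, sq_abs] at h1
    nlinarith
  · rw [maxMargin, dif_neg h]; simp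

/-- Projecting onto the span of the points keeps all margins and does not lengthen the vector. -/
lemma maxMargin_mem_span : maxMargin v S x ∈ Submodule.span ℝ (x '' S) := by
  by_cases h : ∀ i ∈ S, ⟪v, x i⟫ ≠ 0
  · set U := Submodule.span ℝ (x '' S) with hU
    have : FiniteDimensional ℝ U :=
      FiniteDimensional.span_of_finite ℝ (S.finite_toSet.image x)
    set w := maxMargin v S x with hw
    have hm : U.starProjection w ∈ marginSet v S x := fun i hi => by
      have hx : signed v (x i) ∈ U :=
        signed_mem_iff.2 (Submodule.subset_span (Set.mem_image_of_mem x hi))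
      rw [Submodule.inner_starProjection_left_eq_right, Submodule.starProjection_eq_self_iff.2 hx]
      exact maxMargin_mem h i hi
    have := eq_maxMargin h hm (Submodule.norm_starProjection_apply_le _ _)
    rw [← hw] at this
    rw [← this]
    exact Submodule.starProjection_apply_mem _ _
  · rw [maxMargin, dif_neg h]; exact Submodule.zero_mem _

lemma card_le_norm_maxMargin_mul (h : ∀ i ∈ S, ⟪v, x i⟫ ≠ 0) :
    (S.card : ℝ) ≤ ‖maxMargin v S x‖ * ‖∑ i ∈ S, signed v (x i)‖ := by
  refine le_trans ?_ (real_inner_le_norm _ _)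
  rw [inner_sum, Finset.card_eq_sum_ones, Nat.cast_sum]
  exact Finset.sum_le_sum fun i hi => by simpa using maxMargin_mem h i hi

/-- Adding a point increases the squared norm of the maximum margin separator by at most the
squared margin violation, divided by the squared distance to the span of the other points. -/
lemma norm_maxMargin_insert_sq_le [DecidableEq ι] {j : ι}
    (h : ∀ i ∈ insert j S, ⟪v, x i⟫ ≠ 0) (V : Submodule ℝ E) [V.HasOrthogonalProjection]
    (hV : V = (Submodule.span ℝ (x '' S))ᗮ) :
    ENNReal.ofReal (‖maxMargin v (insert j S) x‖ ^ 2 - ‖maxMargin v S x‖ ^ 2) ≤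
      ENNReal.ofReal (2 * (1 + ⟪maxMargin v S x, x j⟫ ^ 2)) *
        (ENNReal.ofReal (‖V.orthogonalProjectionOnto (x j)‖ ^ 2))⁻¹ := by
  have hS : ∀ i ∈ S, ⟪v, x i⟫ ≠ 0 := fun i hi => h i (Finset.mem_insert_of_mem hi)
  set w := maxMargin v S x with hw
  set p := V.starProjection (x j) with hp
  have hpn : ‖V.orthogonalProjectionOnto (x j)‖ = ‖p‖ := rfl
  rw [hpn]
  -- If `x j` lies in the span of the old points, the right-hand side is infinite.
  by_cases hp0 : p = 0
  · rw [hp0]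
    simp only [norm_zero, ne_eq, OfNat.ofNat_ne_zero, not_false_eq_true, zero_pow,
      ENNReal.ofReal_zero, ENNReal.inv_zero]
    rw [ENNReal.mul_top]
    · exact le_top
    · rw [Ne, ENNReal.ofReal_eq_zero, not_le]; positivity
  have hpp : 0 < ‖p‖ := norm_pos_iff.2 hp0
  set z := signed v (x j) with hz
  set q := V.starProjection z with hq
  have hqn : ‖q‖ ^ 2 = ‖p‖ ^ 2 := by
    rw [hq, hp, hz, signed]; split_ifs <;> simp
  have hqz : ⟪q, z⟫ = ‖q‖ ^ 2 := by
    rw [← real_inner_self_eq_norm_sq, hq, Submodule.inner_starProjection_left_eq_right,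
      Submodule.inner_starProjection_left_eq_right, Submodule.starProjection_eq_self_iff.2
        (Submodule.starProjection_apply_mem V z)]
  have hqV : q ∈ (Submodule.span ℝ (x '' S))ᗮ := hV ▸ Submodule.starProjection_apply_mem V z
  have hqS : ∀ u ∈ Submodule.span ℝ (x '' S), ⟪u, q⟫ = 0 := fun u hu =>
    Submodule.inner_right_of_mem_orthogonal hu hqV
  -- Correct `w` along `q`, which is orthogonal to the old points: their margins are unchanged, and
  -- this `a` makes the new margin exactly 1. The competitor has squared norm `‖w‖² + a²‖q‖²`.
  set a := (1 - ⟪w, z⟫) / ‖q‖ ^ 2 with ha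
  have hq0 : ‖q‖ ^ 2 ≠ 0 := by rw [hqn]; positivity
  have hm : w + a • q ∈ marginSet v (insert j S) x := fun i hi => by
    rw [inner_add_left, real_inner_smul_left]
    rcases Finset.mem_insert.1 hi with rfl | hi
    · rw [← hz, hqz, ha, div_mul_cancel₀ _ hq0]; linarith
    · rw [real_inner_comm, real_inner_comm _ q, hqS _ (signed_mem_iff.2
        (Submodule.subset_span (Set.mem_image_of_mem x hi))), mul_zero, add_zero, real_inner_comm]
      exact maxMargin_mem hS i hi
  have hle := maxMargin_norm_sq_add_le h hm
  rw [norm_add_sq_real, real_inner_smul_right, hqS w maxMargin_mem_span, norm_smul, mul_pow,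
    Real.norm_eq_abs, sq_abs] at hle
  have haq : a ^ 2 * ‖q‖ ^ 2 = (1 - ⟪w, z⟫) ^ 2 / ‖q‖ ^ 2 := by
    rw [ha]; field_simp
  have h2 : (1 - ⟪w, z⟫) ^ 2 ≤ 2 * (1 + ⟪w, x j⟫ ^ 2) := by
    rw [← inner_signed_sq v w (x j), ← hz]
    nlinarith [sq_nonneg (1 + ⟪w, z⟫)]
  rw [← ENNReal.ofReal_inv_of_pos (by positivity), ← ENNReal.ofReal_mul (by positivity)]
  refine ENNReal.ofReal_le_ofReal ?_
  rw [← div_eq_mul_inv]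
  calc _ ≤ a ^ 2 * ‖q‖ ^ 2 := by
        nlinarith [sq_nonneg ‖w + a • q - maxMargin v (insert j S) x‖]
    _ = (1 - ⟪w, z⟫) ^ 2 / ‖p‖ ^ 2 := by rw [haq, hqn]
    _ ≤ _ := by gcongr

/-- A small step along `v` makes every constraint strict, so the nearly optimal strictly feasible
vectors form a nonempty open set. -/
lemma exists_denseSeq_mem_marginSet [TopologicalSpace.SeparableSpace E]
    (h : ∀ i ∈ S, ⟪v, x i⟫ ≠ 0) {a : ℝ}
    (ha : ‖maxMargin v S x‖ ^ 2 < a) :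
    ∃ k, TopologicalSpace.denseSeq E k ∈ marginSet v S x ∧
      ‖TopologicalSpace.denseSeq E k‖ ^ 2 < a := by
  set w := maxMargin v S x with hw
  have hc : Continuous fun t : ℝ => ‖w + t • v‖ ^ 2 := by fun_prop
  have h1 : ∀ᶠ t in nhdsWithin (0 : ℝ) (Set.Ioi 0), ‖w + t • v‖ ^ 2 < a :=
    (hc.continuousAt.eventually_lt continuousAt_const (by simpa using ha)).filter_mono
      nhdsWithin_le_nhds
  obtain ⟨t, ht, ht0⟩ := (h1.and self_mem_nhdsWithin).exists
  have ht0 : 0 < t := ht0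
  have hO : IsOpen ({u : E | ∀ i ∈ S, 1 < ⟪u, signed v (x i)⟫} ∩ {u | ‖u‖ ^ 2 < a}) := by
    refine IsOpen.inter ?_ (isOpen_lt (by fun_prop) continuous_const)
    have : {u : E | ∀ i ∈ S, 1 < ⟪u, signed v (x i)⟫} =
        ⋂ i ∈ S, {u : E | 1 < ⟪u, signed v (x i)⟫} := by ext; simp
    rw [this]
    exact isOpen_biInter_finset fun i _ => isOpen_lt continuous_const (by fun_prop)
  obtain ⟨k, hk⟩ := (TopologicalSpace.denseRange_denseSeq E).exists_mem_open hO
    ⟨w + t • v, fun i hi => by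
      rw [inner_add_left, real_inner_smul_left]
      nlinarith [maxMargin_mem h i hi, inner_signed_pos (h i hi), mul_pos ht0
        (inner_signed_pos (h i hi))], ht⟩
  exact ⟨k, fun i hi => (hk.1 i hi).le, hk.2⟩

end MaxMargin

/-! ### Measurability of the separator as a function of the sample. -/

section Measurability

variable {E : Type*} [NormedAddCommGroup E] [InnerProductSpace ℝ E] [FiniteDimensional ℝ E]
  [MeasurableSpace E] [BorelSpace E] {ι : Type*}

lemma measurableSet_mem_marginSet (v w : E) (S : Finset ι) :
    MeasurableSet {x : ι → E | w ∈ marginSet v S x} := by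
  have hms := measurable_signed v
  have : {x : ι → E | w ∈ marginSet v S x} = ⋂ i ∈ S, {x | 1 ≤ ⟪w, signed v (x i)⟫} := by
    ext; simp [marginSet]
  rw [this]
  exact Finset.measurableSet_biInter _ fun i _ => measurableSet_le measurable_const (by fun_prop)

lemma measurableSet_forall_inner_ne_zero (v : E) (S : Finset ι) :
    MeasurableSet {x : ι → E | ∀ i ∈ S, ⟪v, x i⟫ ≠ 0} := by
  have : {x : ι → E | ∀ i ∈ S, ⟪v, x i⟫ ≠ 0} = ⋂ i ∈ S, {x | ⟪v, x i⟫ = 0}ᶜ := by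
    ext; simp
  rw [this]
  exact Finset.measurableSet_biInter _ fun i _ =>
    (measurableSet_eq_fun (by fun_prop) measurable_const).compl

lemma measurable_norm_maxMargin_sq (v : E) (S : Finset ι) :
    Measurable fun x : ι → E => ‖maxMargin v S x‖ ^ 2 := by
  refine measurable_of_Iio fun a => ?_
  have hG := measurableSet_forall_inner_ne_zero (ι := ι) v S
  have : (fun x : ι → E => ‖maxMargin v S x‖ ^ 2) ⁻¹' Set.Iio a =
      ({x : ι → E | ∀ i ∈ S, ⟪v, x i⟫ ≠ 0} ∩ ⋃ k, ({x | TopologicalSpace.denseSeq E k ∈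
        marginSet v S x} ∩ {_x | ‖TopologicalSpace.denseSeq E k‖ ^ 2 < a})) ∪
      ({x : ι → E | ∀ i ∈ S, ⟪v, x i⟫ ≠ 0}ᶜ ∩ {_x | 0 < a}) := by
    ext x
    by_cases h : ∀ i ∈ S, ⟪v, x i⟫ ≠ 0
    · have : x ∉ {x : ι → E | ∀ i ∈ S, ⟪v, x i⟫ ≠ 0}ᶜ := fun hn => hn h
      simp only [Set.mem_preimage, Set.mem_Iio, Set.mem_union, Set.mem_inter_iff, this, false_and,
        or_false, Set.mem_iUnion]
      refine ⟨fun ha => ⟨h, exists_denseSeq_mem_marginSet h ha⟩, ?_⟩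
      rintro ⟨-, k, hk, ha⟩
      refine lt_of_le_of_lt ?_ ha
      have := maxMargin_norm_le h hk
      gcongr
    · have h0 : maxMargin v S x = 0 := by rw [maxMargin, dif_neg h]
      have : x ∉ {x : ι → E | ∀ i ∈ S, ⟪v, x i⟫ ≠ 0} := h
      simp [h0, this]
  rw [this]
  refine (hG.inter (MeasurableSet.iUnion fun k => ?_)).union (hG.compl.inter (.const _))
  exact (measurableSet_mem_marginSet v _ S).inter (.const _)

/-- The separator is a pointwise limit of measurable selections: the first feasible member of a
dense sequence with squared norm within `1/(m+1)` of the minimum. Strong convexity forces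
convergence. -/
lemma measurable_maxMargin (v : E) (S : Finset ι) :
    Measurable fun x : ι → E => maxMargin v S x := by
  classical
  have hG := measurableSet_forall_inner_ne_zero (ι := ι) v S
  let q := TopologicalSpace.denseSeq E
  let P : ℕ → (ι → E) → ℕ → Prop := fun m x k => (∀ i ∈ S, ⟪v, x i⟫ ≠ 0) →
    q k ∈ marginSet v S x ∧ ‖q k‖ ^ 2 < ‖maxMargin v S x‖ ^ 2 + 1 / ((m : ℝ) + 1)
  have hP : ∀ m x, ∃ k, P m x k := fun m x => by
    by_cases h : ∀ i ∈ S, ⟪v, x i⟫ ≠ 0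
    · obtain ⟨k, hk⟩ := exists_denseSeq_mem_marginSet h
        (a := ‖maxMargin v S x‖ ^ 2 + 1 / ((m : ℝ) + 1)) (by
          have : (0 : ℝ) < 1 / ((m : ℝ) + 1) := by positivity
          linarith)
      exact ⟨k, fun _ => hk⟩
    · exact ⟨0, fun h' => absurd h' h⟩
  have hPm : ∀ m k, MeasurableSet {x | P m x k} := fun m k => by
    have : {x | P m x k} = {x : ι → E | ∀ i ∈ S, ⟪v, x i⟫ ≠ 0}ᶜ ∪
        ({x | q k ∈ marginSet v S x} ∩
          {x | ‖q k‖ ^ 2 < ‖maxMargin v S x‖ ^ 2 + 1 / ((m : ℝ) + 1)}) := by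
      ext x
      simp only [P, Set.mem_ofPred_eq, Set.mem_union, Set.mem_compl_iff, Set.mem_inter_iff,
        imp_iff_not_or]
    rw [this]
    exact hG.compl.union ((measurableSet_mem_marginSet v _ S).inter
      (measurableSet_lt measurable_const ((measurable_norm_maxMargin_sq v S).add_const _)))
  let f : ℕ → (ι → E) → E := fun m x =>
    if ∀ i ∈ S, ⟪v, x i⟫ ≠ 0 then q (Nat.find (hP m x)) else 0
  have hf : ∀ m, Measurable (f m) := fun m =>
    Measurable.ite hG ((measurable_from_nat (f := q)).comp (measurable_find (hP m) (hPm m)))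
      measurable_const
  refine measurable_of_tendsto_metrizable hf (tendsto_pi_nhds.2 fun x => ?_)
  by_cases h : ∀ i ∈ S, ⟪v, x i⟫ ≠ 0
  · have hlim := tendsto_one_div_add_atTop_nhds_zero_nat (𝕜 := ℝ)
    have h2 : Filter.Tendsto (fun m => ‖f m x - maxMargin v S x‖ ^ 2) Filter.atTop (nhds 0) := by
      refine squeeze_zero (fun m => sq_nonneg _) (fun m => ?_) hlim
      simp only [f, if_pos h]
      obtain ⟨h3, h4⟩ := Nat.find_spec (hP m x) h
      have := maxMargin_norm_sq_add_le h h3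
      linarith
    have h3 := h2.sqrt
    simp only [Real.sqrt_sq (norm_nonneg _), Real.sqrt_zero] at h3
    exact tendsto_iff_norm_sub_tendsto_zero.2 h3
  · have h0 : maxMargin v S x = 0 := by rw [maxMargin, dif_neg h]
    simp only [f, if_neg h, h0]
    exact tendsto_const_nhds

end Measurability

/-! ### Resampling a single coordinate of a product measure. -/

lemma measurable_update_prod {ι X : Type*} [DecidableEq ι] [MeasurableSpace X] (j : ι) :
    Measurable fun z : (ι → X) × X => Function.update z.1 j z.2 := by
  refine measurable_pi_iff.2 fun i => ?_
  by_cases h : i = j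
  · subst h; simpa using measurable_snd
  · simp only [Function.update_of_ne h]; fun_prop

lemma map_update_pi_prod {ι X : Type*} [Fintype ι] [DecidableEq ι] [MeasurableSpace X]
    (ν : Measure X) [IsProbabilityMeasure ν] (j : ι) :
    ((Measure.pi fun _ : ι => ν).prod ν).map (fun z => Function.update z.1 j z.2) =
      Measure.pi fun _ : ι => ν := by
  have hm := measurable_update_prod (X := X) j
  refine (Measure.pi_eq fun s hs => ?_).symm
  rw [Measure.map_apply hm (MeasurableSet.univ_pi hs)]
  have : (fun z : (ι → X) × X => Function.update z.1 j z.2) ⁻¹' Set.univ.pi s =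
      (Set.univ.pi (Function.update s j Set.univ)) ×ˢ s j := by
    ext ⟨x, y⟩
    simp only [Set.mem_preimage, Set.mem_pi, Set.mem_univ, true_implies, Set.mem_prod]
    constructor
    · refine fun h => ⟨fun i => ?_, by simpa using h j⟩
      by_cases hi : i = j
      · subst hi; simp
      · simpa [Function.update_of_ne hi] using h i
    · rintro ⟨h, hy⟩ i
      by_cases hi : i = j
      · subst hi; simpa using hy
      · simpa [Function.update_of_ne hi] using h i
  rw [this, Measure.prod_prod, Measure.pi_pi, ← Finset.prod_erase_mul _ _ (Finset.mem_univ j),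
    ← Finset.prod_erase_mul _ (fun i => ν (s i)) (Finset.mem_univ j)]
  simp only [Function.update_self, measure_univ, mul_one]
  congr 1
  exact Finset.prod_congr rfl fun i hi => by
    rw [Function.update_of_ne (Finset.ne_of_mem_erase hi)]

/-- Under a product measure, a single coordinate can be integrated first. -/
lemma lintegral_pi_update {ι X : Type*} [Fintype ι] [DecidableEq ι] [MeasurableSpace X]
    (ν : Measure X) [IsProbabilityMeasure ν] (j : ι) {f : (ι → X) → ENNReal}
    (hf : Measurable f) :
    ∫⁻ x, f x ∂(Measure.pi fun _ : ι => ν) =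
      ∫⁻ x, ∫⁻ y, f (Function.update x j y) ∂ν ∂(Measure.pi fun _ : ι => ν) := by
  have hm := measurable_update_prod (X := X) j
  conv_lhs => rw [← map_update_pi_prod ν j]
  rw [lintegral_map hf hm]
  exact lintegral_prod _ (hf.comp hm).aemeasurable

/-! ### Expected growth and stability of the separator on a Gaussian sample. -/

section GaussianSample

/-- The law of a family of independent standard Gaussian vectors indexed by `ι`. -/
noncomputable abbrev gaussianSample (ι E : Type*) [Fintype ι] [NormedAddCommGroup E]
    [InnerProductSpace ℝ E] [FiniteDimensional ℝ E] [MeasurableSpace E] : Measure (ι → E) :=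
  Measure.pi fun _ => stdGaussian E

variable {E : Type*} [NormedAddCommGroup E] [InnerProductSpace ℝ E] [FiniteDimensional ℝ E]
  [MeasurableSpace E] [BorelSpace E] {ι : Type*} [Fintype ι]

lemma ae_inner_ne_zero {v : E} (hv : v ≠ 0) :
    ∀ᵐ x ∂(gaussianSample ι E), ∀ i, ⟪v, x i⟫ ≠ 0 := by
  refine ae_all_iff.2 fun i => ?_
  have h : ∀ᵐ y ∂(stdGaussian E), ⟪v, y⟫ ≠ 0 := by
    rw [ae_iff]; simpa using stdGaussian_inner_eq_zero hv
  exact (measurePreserving_eval (fun _ : ι => stdGaussian E) i).quasiMeasurePreserving.ae h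

variable [DecidableEq ι]

/-- Integrate over `x j` first: `maxMargin v S x` does not depend on it and lies in the span of the
other points, whose orthogonal complement has dimension at least `D - |ι|`. -/
lemma lintegral_maxMargin_insert_sub_le {v : E} (hv : v ≠ 0) {S : Finset ι} {j : ι} (hj : j ∉ S)
    (hd : (Fintype.card ι : ℝ) + 2 < Module.finrank ℝ E) :
    ∫⁻ x, ENNReal.ofReal (‖maxMargin v (insert j S) x‖ ^ 2 - ‖maxMargin v S x‖ ^ 2)
        ∂(gaussianSample ι E) ≤
      ENNReal.ofReal (2 / (Module.finrank ℝ E - Fintype.card ι - 2)) *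
        ∫⁻ x, ENNReal.ofReal (1 + ‖maxMargin v S x‖ ^ 2) ∂(gaussianSample ι E) := by
  have hm1 := measurable_norm_maxMargin_sq (ι := ι) v S
  have hm2 := measurable_norm_maxMargin_sq (ι := ι) v (insert j S)
  rw [lintegral_pi_update _ j (by fun_prop), ← lintegral_const_mul _ (by fun_prop)]
  refine lintegral_mono_ae ?_
  filter_upwards [ae_inner_ne_zero hv] with x hx
  set U := Submodule.span ℝ (x '' S) with hU
  have hUd : Module.finrank ℝ U ≤ Fintype.card ι :=
    (Submodule.finrank_mono (Submodule.span_mono (Set.image_subset_range x _))).trans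
      (finrank_range_le_card x)
  have hUo : (Module.finrank ℝ E : ℝ) - Fintype.card ι ≤ Module.finrank ℝ Uᗮ := by
    have h1 := U.finrank_add_finrank_orthogonal
    have h2 : (Module.finrank ℝ E : ℝ) = Module.finrank ℝ U + Module.finrank ℝ Uᗮ := by
      exact_mod_cast h1.symm
    have h3 : (Module.finrank ℝ U : ℝ) ≤ Fintype.card ι := by exact_mod_cast hUd
    linarith
  have hw : maxMargin v S x ∈ Uᗮᗮ := by
    rw [Submodule.orthogonal_orthogonal]; exact maxMargin_mem_span
  have h2 : 2 < Module.finrank ℝ Uᗮ := by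
    have : (2 : ℝ) < Module.finrank ℝ Uᗮ := by linarith
    exact_mod_cast this
  have hae : ∀ᵐ y ∂(stdGaussian E), ⟪v, y⟫ ≠ 0 := by
    rw [ae_iff]; simpa using stdGaussian_inner_eq_zero hv
  calc ∫⁻ y, ENNReal.ofReal (‖maxMargin v (insert j S) (Function.update x j y)‖ ^ 2 -
        ‖maxMargin v S (Function.update x j y)‖ ^ 2) ∂(stdGaussian E)
      ≤ ∫⁻ y, ENNReal.ofReal (2 * (1 + ⟪maxMargin v S x, y⟫ ^ 2)) *
          (ENNReal.ofReal (‖Uᗮ.orthogonalProjectionOnto y‖ ^ 2))⁻¹ ∂(stdGaussian E) := by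
        refine lintegral_mono_ae ?_
        filter_upwards [hae] with y hy
        have himg : (Function.update x j y) '' S = x '' S :=
          Set.image_congr fun i hi => Function.update_of_ne (ne_of_mem_of_not_mem hi hj) _ _
        have h := norm_maxMargin_insert_sq_le (v := v) (S := S) (j := j)
          (x := Function.update x j y) (fun i _ => by
            by_cases hi : i = j
            · subst hi; simpa using hy
            · simpa [Function.update_of_ne hi] using hx i) Uᗮ (by rw [himg])
        rw [maxMargin_update hj, Function.update_self] at h
        rwa [maxMargin_update hj]
    _ ≤ ENNReal.ofReal (2 / (Module.finrank ℝ Uᗮ - 2)) *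
          ENNReal.ofReal (1 + ‖maxMargin v S x‖ ^ 2) :=
        lintegral_inner_mul_inv_norm_sq_projection hw h2
    _ ≤ _ := by
        gcongr ENNReal.ofReal ?_ * _
        refine div_le_div_of_nonneg_left (by norm_num) (by linarith) (by linarith)

lemma lintegral_one_add_norm_maxMargin_sq_le {v : E} (hv : v ≠ 0) (S : Finset ι)
    (hd : 5 * (Fintype.card ι : ℝ) + 2 < Module.finrank ℝ E) :
    ∫⁻ x, ENNReal.ofReal (1 + ‖maxMargin v S x‖ ^ 2) ∂(gaussianSample ι E) ≤ 2 := by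
  set c : ℝ := 2 / (Module.finrank ℝ E - Fintype.card ι - 2) with hc
  have hn0 : (0 : ℝ) ≤ Fintype.card ι := by positivity
  have hc0 : 0 ≤ c := div_nonneg (by norm_num) (by linarith)
  have key : ∀ S : Finset ι, ∫⁻ x, ENNReal.ofReal (1 + ‖maxMargin v S x‖ ^ 2)
      ∂(gaussianSample ι E) ≤ ENNReal.ofReal ((1 + c) ^ S.card) := by
    intro S
    induction S using Finset.induction_on with
    | empty => simp [maxMargin_empty]
    | insert j S hj ih =>
      have hm1 := measurable_norm_maxMargin_sq (ι := ι) v S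
      have hm2 := measurable_norm_maxMargin_sq (ι := ι) v (insert j S)
      calc ∫⁻ x, ENNReal.ofReal (1 + ‖maxMargin v (insert j S) x‖ ^ 2) ∂(gaussianSample ι E)
          ≤ ∫⁻ x, (ENNReal.ofReal (1 + ‖maxMargin v S x‖ ^ 2) + ENNReal.ofReal
              (‖maxMargin v (insert j S) x‖ ^ 2 - ‖maxMargin v S x‖ ^ 2))
              ∂(gaussianSample ι E) := by
            refine lintegral_mono fun x => ?_
            refine le_trans (ENNReal.ofReal_le_ofReal ?_) ENNReal.ofReal_add_le
            linarith
        _ ≤ ∫⁻ x, ENNReal.ofReal (1 + ‖maxMargin v S x‖ ^ 2) ∂(gaussianSample ι E) +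
            ENNReal.ofReal c *
              ∫⁻ x, ENNReal.ofReal (1 + ‖maxMargin v S x‖ ^ 2) ∂(gaussianSample ι E) := by
            rw [lintegral_add_left (by fun_prop)]
            exact add_le_add le_rfl (lintegral_maxMargin_insert_sub_le hv hj (by linarith))
        _ ≤ ENNReal.ofReal ((1 + c) ^ S.card) +
            ENNReal.ofReal c * ENNReal.ofReal ((1 + c) ^ S.card) := by gcongr
        _ = _ := by
            rw [← ENNReal.ofReal_mul hc0, ← ENNReal.ofReal_add (by positivity) (by positivity),
              Finset.card_insert_of_notMem hj]
            congr 1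
            ring
  refine (key S).trans ?_
  rw [show (2 : ENNReal) = ENNReal.ofReal 2 by simp]
  refine ENNReal.ofReal_le_ofReal ?_
  -- The assumption on the dimension gives `D - |ι| - 2 ≥ 4|ι|`; hence the growth factor `(1+c)^|ι|`
  -- is at most `exp(1/2) ≤ 2`.
  have hcn : c * Fintype.card ι ≤ 1 / 2 := by
    rw [hc, div_mul_eq_mul_div, div_le_iff₀ (by linarith)]; linarith
  calc (1 + c) ^ S.card ≤ (1 + c) ^ Fintype.card ι :=
        pow_le_pow_right₀ (by linarith) (Finset.card_le_univ S)
    _ ≤ Real.exp c ^ Fintype.card ι := by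
        gcongr
        linarith [Real.add_one_le_exp c]
    _ = Real.exp (c * Fintype.card ι) := by rw [← Real.exp_nat_mul, mul_comm]
    _ ≤ Real.exp (1 / 2) := Real.exp_le_exp.2 hcn
    _ ≤ 2 := by
        have h1 : Real.exp (1 / 2) ^ 2 = Real.exp 1 := by rw [← Real.exp_nat_mul]; norm_num
        nlinarith [Real.exp_one_lt_d9, Real.exp_pos (1 / 2)]

/-- Insert the points of `T \ S` one at a time. The increments of the squared norm telescope, and
their total dominates the squared distance. -/
lemma lintegral_norm_maxMargin_sub_sq_le {v : E} (hv : v ≠ 0) {S T : Finset ι} (hST : S ⊆ T)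
    (hd : 5 * (Fintype.card ι : ℝ) + 2 < Module.finrank ℝ E) :
    ∫⁻ x, ENNReal.ofReal (‖maxMargin v T x - maxMargin v S x‖ ^ 2) ∂(gaussianSample ι E) ≤
      ENNReal.ofReal ((T \ S).card * (4 / (Module.finrank ℝ E - Fintype.card ι - 2))) := by
  set c : ℝ := 2 / (Module.finrank ℝ E - Fintype.card ι - 2) with hc
  have hn0 : (0 : ℝ) ≤ Fintype.card ι := by positivity
  have hc0 : 0 ≤ c := div_nonneg (by norm_num) (by linarith)
  have key : ∀ R : Finset ι, Disjoint R S → ∫⁻ x, ENNReal.ofReal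
      (‖maxMargin v (R ∪ S) x‖ ^ 2 - ‖maxMargin v S x‖ ^ 2) ∂(gaussianSample ι E) ≤
        ENNReal.ofReal (R.card * (2 * c)) := by
    intro R
    induction R using Finset.induction_on with
    | empty => simp
    | insert j R hj ih =>
      intro hdis
      rw [Finset.disjoint_insert_left] at hdis
      have hj' : j ∉ R ∪ S := by simp [hj, hdis.1]
      have hm1 := measurable_norm_maxMargin_sq (ι := ι) v S
      have hm2 := measurable_norm_maxMargin_sq (ι := ι) v (R ∪ S)
      have hm3 := measurable_norm_maxMargin_sq (ι := ι) v (insert j (R ∪ S))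
      rw [Finset.insert_union]
      calc _ ≤ ∫⁻ x, (ENNReal.ofReal (‖maxMargin v (R ∪ S) x‖ ^ 2 - ‖maxMargin v S x‖ ^ 2) +
              ENNReal.ofReal (‖maxMargin v (insert j (R ∪ S)) x‖ ^ 2 -
                ‖maxMargin v (R ∪ S) x‖ ^ 2)) ∂(gaussianSample ι E) := by
            refine lintegral_mono fun x => ?_
            refine le_trans (ENNReal.ofReal_le_ofReal ?_) ENNReal.ofReal_add_le
            linarith
        _ ≤ ENNReal.ofReal (R.card * (2 * c)) + ENNReal.ofReal c * 2 := by
            rw [lintegral_add_left (by fun_prop)]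
            refine add_le_add (ih hdis.2) ((lintegral_maxMargin_insert_sub_le hv hj'
              (by linarith)).trans ?_)
            gcongr
            exact lintegral_one_add_norm_maxMargin_sq_le hv _ hd
        _ = _ := by
            rw [show (2 : ENNReal) = ENNReal.ofReal 2 by simp, ← ENNReal.ofReal_mul hc0,
              ← ENNReal.ofReal_add (by positivity) (by positivity),
              Finset.card_insert_of_notMem hj]
            congr 1
            push_cast
            ring
  have h := key (T \ S) Finset.sdiff_disjoint
  rw [Finset.sdiff_union_of_subset hST, show 2 * c = 4 / (Module.finrank ℝ E -
    Fintype.card ι - 2) by rw [hc]; ring] at h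
  refine le_trans (lintegral_mono_ae ?_) h
  filter_upwards [ae_inner_ne_zero hv] with x hx
  exact ENNReal.ofReal_le_ofReal (maxMargin_sub_norm_sq_le hST fun i _ => hx i)

/-- Neither separator involves `x i`, so integrating over `x i` turns the squared inner product into
the squared distance of the separators; Markov's inequality concludes. -/
lemma gaussianSample_one_le_inner_sub_le {v : E} (hv : v ≠ 0) {S T : Finset ι} (hST : S ⊆ T)
    {i : ι} (hi : i ∉ T) (hd : 5 * (Fintype.card ι : ℝ) + 2 < Module.finrank ℝ E) :
    gaussianSample ι E {x | 1 ≤ ⟪maxMargin v S x - maxMargin v T x, signed v (x i)⟫} ≤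
      ENNReal.ofReal ((T \ S).card * (4 / (Module.finrank ℝ E - Fintype.card ι - 2))) := by
  have hm1 := measurable_maxMargin (ι := ι) v S
  have hm2 := measurable_maxMargin (ι := ι) v T
  have hf : Measurable fun x : ι → E =>
      ENNReal.ofReal (⟪maxMargin v S x - maxMargin v T x, x i⟫ ^ 2) := by fun_prop
  have h1 : gaussianSample ι E {x | 1 ≤ ⟪maxMargin v S x - maxMargin v T x, signed v (x i)⟫} ≤
      ∫⁻ x, ENNReal.ofReal (⟪maxMargin v S x - maxMargin v T x, x i⟫ ^ 2)
        ∂(gaussianSample ι E) := by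
    refine meas_le_lintegral₀ hf.aemeasurable fun x hx => ?_
    have hx : 1 ≤ ⟪maxMargin v S x - maxMargin v T x, signed v (x i)⟫ := hx
    rw [ENNReal.one_le_ofReal, ← inner_signed_sq v]
    nlinarith
  refine h1.trans (le_trans (le_of_eq ?_) (lintegral_norm_maxMargin_sub_sq_le hv hST hd))
  rw [lintegral_pi_update _ i hf]
  refine lintegral_congr fun x => ?_
  rw [norm_sub_rev, ← lintegral_inner_sq_stdGaussian]
  refine lintegral_congr fun y => ?_
  rw [maxMargin_update hi, maxMargin_update (fun h => hi (hST h)), Function.update_self]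

/-- Both `G` and the separator of `B` are unaffected by the coordinates in `A`, so these act as
independent trials, peeled off one by one with a factor `1 - p` each. -/
lemma gaussianSample_forall_inner_lt_le {v : E} {B : Finset ι} {G : Set (ι → E)}
    (hG : MeasurableSet G) {p : ℝ} (hp0 : 0 ≤ p) (hp1 : p ≤ 1) {t : ℝ}
    (hGp : ∀ x ∈ G, ENNReal.ofReal p ≤
      stdGaussian E {y | t ≤ ⟪maxMargin v B x, signed v y⟫})
    (A : Finset ι) (hAB : Disjoint A B)
    (hGA : ∀ i ∈ A, ∀ x y, Function.update x i y ∈ G ↔ x ∈ G) :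
    gaussianSample ι E (G ∩ {x | ∀ i ∈ A, ⟪maxMargin v B x, signed v (x i)⟫ < t}) ≤
      ENNReal.ofReal ((1 - p) ^ A.card) := by
  have hms := measurable_signed v
  have hmB := measurable_maxMargin (ι := ι) v B
  have hmeas : ∀ A : Finset ι, MeasurableSet
      (G ∩ {x | ∀ i ∈ A, ⟪maxMargin v B x, signed v (x i)⟫ < t}) := fun A => by
    refine hG.inter ?_
    have : {x : ι → E | ∀ i ∈ A, ⟪maxMargin v B x, signed v (x i)⟫ < t} =
        ⋂ i ∈ A, {x | ⟪maxMargin v B x, signed v (x i)⟫ < t} := by ext; simp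
    rw [this]
    exact Finset.measurableSet_biInter _ fun i _ => measurableSet_lt (by fun_prop)
      measurable_const
  induction A using Finset.induction_on with
  | empty => simpa using prob_le_one
  | insert j A hj ih =>
    rw [Finset.disjoint_insert_left] at hAB
    have ih' := ih hAB.2 fun i hi => hGA i (Finset.mem_insert_of_mem hi)
    set Q := G ∩ {x : ι → E | ∀ i ∈ A, ⟪maxMargin v B x, signed v (x i)⟫ < t} with hQ
    rw [← lintegral_indicator_one (hmeas _),
      lintegral_pi_update _ j (measurable_one.indicator (hmeas _))]
    have hp1' : 0 ≤ 1 - p := by linarith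
    calc _ ≤ ∫⁻ x, ENNReal.ofReal (1 - p) * Q.indicator 1 x ∂(gaussianSample ι E) := by
          refine lintegral_mono fun x => ?_
          have hsub : ∀ y, Function.update x j y ∈ G ∩ {x : ι → E | ∀ i ∈ insert j A,
              ⟪maxMargin v B x, signed v (x i)⟫ < t} →
              x ∈ Q ∧ ⟪maxMargin v B x, signed v y⟫ < t := by
            rintro y ⟨hy, hA⟩
            refine ⟨⟨(hGA j (Finset.mem_insert_self _ _) x y).1 hy, fun i hi => ?_⟩, ?_⟩
            · have := hA i (Finset.mem_insert_of_mem hi)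
              rwa [maxMargin_update hAB.1, Function.update_of_ne (ne_of_mem_of_not_mem hi hj)]
                at this
            · have := hA j (Finset.mem_insert_self _ _)
              rwa [maxMargin_update hAB.1, Function.update_self] at this
          have hmx : MeasurableSet {y | t ≤ ⟪maxMargin v B x, signed v y⟫} :=
            measurableSet_le measurable_const (by fun_prop)
          by_cases hx : x ∈ Q
          · rw [Set.indicator_of_mem hx, Pi.one_apply, mul_one]
            calc _ ≤ ∫⁻ y, {y | t ≤ ⟪maxMargin v B x, signed v y⟫}ᶜ.indicator 1 y
                  ∂(stdGaussian E) := by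
                  refine lintegral_mono fun y => ?_
                  by_cases hy : Function.update x j y ∈ G ∩ {x : ι → E | ∀ i ∈ insert j A,
                      ⟪maxMargin v B x, signed v (x i)⟫ < t}
                  · rw [Set.indicator_of_mem hy, Set.indicator_of_mem]
                    · simp
                    · exact not_le.2 (hsub y hy).2
                  · rw [Set.indicator_of_notMem hy]; exact zero_le
              _ = 1 - stdGaussian E {y | t ≤ ⟪maxMargin v B x, signed v y⟫} := by
                  rw [lintegral_indicator_one hmx.compl, prob_compl_eq_one_sub hmx]
              _ ≤ 1 - ENNReal.ofReal p := tsub_le_tsub_left (hGp x hx.1) _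
              _ = _ := by rw [ENNReal.ofReal_sub _ hp0, ENNReal.ofReal_one]
          · rw [Set.indicator_of_notMem hx, mul_zero]
            refine le_of_eq ((lintegral_congr fun y => ?_).trans lintegral_zero)
            exact Set.indicator_of_notMem (fun hy => hx (hsub y hy).1) _
      _ = ENNReal.ofReal (1 - p) * gaussianSample ι E Q := by
          rw [lintegral_const_mul _ (measurable_one.indicator (hmeas _)),
            lintegral_indicator_one (hmeas _)]
      _ ≤ ENNReal.ofReal (1 - p) * ENNReal.ofReal ((1 - p) ^ A.card) := by gcongr
      _ = _ := by
          rw [← ENNReal.ofReal_mul hp1', Finset.card_insert_of_notMem hj, pow_succ']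

end GaussianSample

/-! ### Leave-one-out margins and the probability that all are at most one. -/

/-- If every point is a support vector, then no point is separated with margin greater than one by
the maximum margin separator of the others. -/
lemma SVPOccurs.inner_maxMargin_erase_le {n d : ℕ} {v : EuclideanSpace ℝ (Fin d)}
    {x : Fin n → EuclideanSpace ℝ (Fin d)} (hx : ∀ i, ⟪v, x i⟫ ≠ 0)
    (h : SVPOccurs x fun i => Real.sign ⟪v, x i⟫) (i : Fin n) :
    ⟪maxMargin v (Finset.univ.erase i) x, signed v (x i)⟫ ≤ 1 := by
  obtain ⟨w, ⟨hw, hmin⟩, hsv⟩ := h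
  have hinner : ∀ (u : EuclideanSpace ℝ (Fin d)) j,
      ⟪u, signed v (x j)⟫ = Real.sign ⟪v, x j⟫ * ⟪u, x j⟫ := fun u j => by
    rw [signed_eq_sign_smul (hx j), real_inner_smul_right]
  by_contra hc
  rw [not_le] at hc
  set u := maxMargin v (Finset.univ.erase i) x with hu
  have hne : ∀ j ∈ Finset.univ.erase i, ⟪v, x j⟫ ≠ 0 := fun j _ => hx j
  have hfeas : u ∈ svmFeasible x fun i => Real.sign ⟪v, x i⟫ := fun j => by
    rw [← hinner]
    by_cases hj : j = i
    · subst hj; exact hc.le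
    · exact maxMargin_mem hne j (Finset.mem_erase.2 ⟨hj, Finset.mem_univ j⟩)
  -- `u` satisfies all `n` constraints, so `w` is no longer than `u`; yet `u` is the unique
  -- minimizer for the weaker system without `i`.
  have hwu : w = u := by
    refine eq_maxMargin hne (fun j _ => ?_) (hmin hfeas)
    rw [hinner]
    exact hw j
  have h1 : Real.sign ⟪v, x i⟫ * ⟪w, x i⟫ = 1 := hsv i
  rw [← hinner, hwu] at h1
  linarith

section GaussianSample

variable {E : Type*} [NormedAddCommGroup E] [InnerProductSpace ℝ E] [FiniteDimensional ℝ E]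
  [MeasurableSpace E] [BorelSpace E] {ι : Type*} [Fintype ι]

lemma stdGaussian_two_le_inner_maxMargin_ge {v : E} (hv : ‖v‖ = 1) {B : Finset ι} {x : ι → E}
    (hB : 0 < B.card) (hBn : Fintype.card ι ≤ 2 * B.card) (hx : ∀ i ∈ B, ⟪v, x i⟫ ≠ 0)
    (hsum : ‖∑ i ∈ B, signed v (x i)‖ ^ 2 ≤ 8 * (B.card : ℝ) * Module.finrank ℝ E) :
    ENNReal.ofReal (Real.exp (-(64 * Module.finrank ℝ E / Fintype.card ι + 1)) / 6) ≤
      stdGaussian E {y | 2 ≤ ⟪maxMargin v B x, signed v y⟫} := by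
  set w := maxMargin v B x with hw
  set D : ℝ := ((Module.finrank ℝ E : ℕ) : ℝ) with hD
  have hb : (0 : ℝ) < B.card := by exact_mod_cast hB
  have hbn : (Fintype.card ι : ℝ) ≤ 2 * B.card := by exact_mod_cast hBn
  have hn : (0 : ℝ) < Fintype.card ι := by
    exact_mod_cast hB.trans_le (Finset.card_le_univ B)
  have h1 := card_le_norm_maxMargin_mul hx
  rw [← hw] at h1
  have hw0 : w ≠ 0 := fun h0 => by
    rw [h0, norm_zero, zero_mul] at h1
    linarith
  have hwp : 0 < ‖w‖ := norm_pos_iff.2 hw0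
  have h2 : (B.card : ℝ) ≤ ‖w‖ ^ 2 * (8 * D) := by
    have h3 : (B.card : ℝ) ^ 2 ≤ ‖w‖ ^ 2 * (8 * B.card * D) := by
      calc (B.card : ℝ) ^ 2 ≤ (‖w‖ * ‖∑ i ∈ B, signed v (x i)‖) ^ 2 := by gcongr
        _ = ‖w‖ ^ 2 * ‖∑ i ∈ B, signed v (x i)‖ ^ 2 := by ring
        _ ≤ _ := by gcongr
    have h4 : (B.card : ℝ) * B.card ≤ B.card * (‖w‖ ^ 2 * (8 * D)) := by linarith
    exact le_of_mul_le_mul_left h4 hb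
  refine le_trans (ENNReal.ofReal_le_ofReal ?_)
    (stdGaussian_le_inner_signed_ge hv hw0 (inner_maxMargin_nonneg hv) 2)
  -- From `h2` and `|ι| ≤ 2|B|`, `‖w‖² ≥ |ι|/(16D)`.
  have h5 : 2 ^ 2 / ‖w‖ ^ 2 ≤ 64 * D / Fintype.card ι := by
    rw [div_le_div_iff₀ (by positivity) hn]
    nlinarith
  gcongr

/-- The probability that no point is separated with margin greater than one by the maximum margin
separator of the others. -/
lemma gaussianSample_forall_inner_maxMargin_erase_le [DecidableEq ι] {v : E} (hv : ‖v‖ = 1) (A : Finset ι)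
    (hA : 0 < Aᶜ.card) (hAn : Fintype.card ι ≤ 2 * Aᶜ.card)
    (hd : 5 * (Fintype.card ι : ℝ) + 2 < Module.finrank ℝ E) :
    gaussianSample ι E {x | (∀ i, ⟪v, x i⟫ ≠ 0) ∧
        ∀ i, ⟪maxMargin v (Finset.univ.erase i) x, signed v (x i)⟫ ≤ 1} ≤
      ENNReal.ofReal (Real.exp (-(1 / 2) * Module.finrank ℝ E) +
        (1 - Real.exp (-(64 * Module.finrank ℝ E / Fintype.card ι + 1)) / 6) ^ A.card +
        A.card * (A.card * (4 / (Module.finrank ℝ E - Fintype.card ι - 2)))) := by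
  have hv0 : v ≠ 0 := by rintro rfl; simp at hv
  have hn0 : (0 : ℝ) ≤ Fintype.card ι := by positivity
  have hms := measurable_signed v
  set B := Aᶜ with hB
  set D : ℝ := ((Module.finrank ℝ E : ℕ) : ℝ) with hD
  set p : ℝ := Real.exp (-(64 * D / Fintype.card ι + 1)) / 6 with hp
  have hp0 : 0 ≤ p := by positivity
  have hp1 : p ≤ 1 := by
    have : Real.exp (-(64 * D / Fintype.card ι + 1)) ≤ 1 := by
      rw [Real.exp_le_one_iff]
      have : 0 ≤ 64 * D / Fintype.card ι := by positivity
      linarith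
    linarith
  set c : ℝ := 4 / (D - Fintype.card ι - 2) with hc
  have hc0 : 0 ≤ c := div_nonneg (by norm_num) (by linarith)
  let G : Set (ι → E) := {x | ∀ i ∈ B, ⟪v, x i⟫ ≠ 0} ∩
    {x | ‖∑ i ∈ B, signed v (x i)‖ ^ 2 ≤ 8 * (B.card : ℝ) * D}
  have hG : MeasurableSet G := (measurableSet_forall_inner_ne_zero v B).inter
    (measurableSet_le (by fun_prop) measurable_const)
  have hGA : ∀ i ∈ A, ∀ x y, Function.update x i y ∈ G ↔ x ∈ G := fun i hi x y => by
    have hu : ∀ j ∈ B, Function.update x i y j = x j := fun j hj =>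
      Function.update_of_ne (ne_of_mem_of_not_mem hi (Finset.mem_compl.1 hj)).symm _ _
    have e1 : (∀ j ∈ B, ⟪v, Function.update x i y j⟫ ≠ 0) ↔ ∀ j ∈ B, ⟪v, x j⟫ ≠ 0 :=
      forall₂_congr fun j hj => by rw [hu j hj]
    have e2 : ∑ j ∈ B, signed v (Function.update x i y j) = ∑ j ∈ B, signed v (x j) :=
      Finset.sum_congr rfl fun j hj => by rw [hu j hj]
    change (_ ∧ _) ↔ (_ ∧ _)
    exact and_congr e1 (by rw [Set.mem_ofPred_eq, Set.mem_ofPred_eq, e2])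
  -- Outside the first two events some `i ∈ A` has margin at least 2 under the separator of `B`. A
  -- leave-one-out margin at most 1 then means a drop of at least 1.
  have hsub : {x : ι → E | (∀ i, ⟪v, x i⟫ ≠ 0) ∧
      ∀ i, ⟪maxMargin v (Finset.univ.erase i) x, signed v (x i)⟫ ≤ 1} ⊆
      ({x | 8 * (B.card : ℝ) * D < ‖∑ i ∈ B, signed v (x i)‖ ^ 2} ∪
        (G ∩ {x | ∀ i ∈ A, ⟪maxMargin v B x, signed v (x i)⟫ < 2})) ∪
      ⋃ i ∈ A, {x | 1 ≤ ⟪maxMargin v B x - maxMargin v (Finset.univ.erase i) x,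
        signed v (x i)⟫} := by
    rintro x ⟨hx, hle⟩
    by_cases h1 : ‖∑ i ∈ B, signed v (x i)‖ ^ 2 ≤ 8 * (B.card : ℝ) * D
    · by_cases h2 : ∀ i ∈ A, ⟪maxMargin v B x, signed v (x i)⟫ < 2
      · exact Or.inl (Or.inr ⟨⟨fun i _ => hx i, h1⟩, h2⟩)
      · right
        push Not at h2
        obtain ⟨i, hi, h3⟩ := h2
        refine Set.mem_iUnion₂.2 ⟨i, hi, ?_⟩
        change 1 ≤ ⟪_, _⟫
        rw [inner_sub_left]
        linarith [hle i]
    · exact Or.inl (Or.inl (not_le.1 h1))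
  refine (measure_mono hsub).trans ((measure_union_le _ _).trans ?_)
  rw [ENNReal.ofReal_add (by have : 0 ≤ 1 - p := by linarith
                             positivity) (by positivity),
    ENNReal.ofReal_add (by positivity) (pow_nonneg (by linarith) _)]
  refine add_le_add ((measure_union_le _ _).trans (add_le_add ?_ ?_)) ?_
  · refine pi_stdGaussian_norm_sq_sum_signed_le v B ?_
    have : (Fintype.card ι : ℝ) ≤ Module.finrank ℝ E := by linarith
    exact_mod_cast this
  · exact gaussianSample_forall_inner_lt_le hG hp0 hp1
      (fun x hx => stdGaussian_two_le_inner_maxMargin_ge hv hA hAn hx.1 hx.2) A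
      disjoint_compl_right hGA
  · refine (measure_biUnion_finset_le _ _).trans ?_
    have : ∀ i ∈ A, gaussianSample ι E {x | 1 ≤ ⟪maxMargin v B x -
        maxMargin v (Finset.univ.erase i) x, signed v (x i)⟫} ≤ ENNReal.ofReal (A.card * c) := fun i hi => by
      have hs : B ⊆ Finset.univ.erase i := fun j hj => Finset.mem_erase.2
        ⟨fun h => Finset.mem_compl.1 hj (h ▸ hi), Finset.mem_univ j⟩
      refine (gaussianSample_one_le_inner_sub_le hv0 hs (Finset.notMem_erase i _) hd).trans
        (ENNReal.ofReal_le_ofReal ?_)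
      have hcard : (Finset.univ.erase i \ B).card ≤ A.card := by
        refine Finset.card_le_card fun j hj => ?_
        simpa [hB] using (Finset.mem_sdiff.1 hj).2
      have hcard' : ((Finset.univ.erase i \ B).card : ℝ) ≤ A.card := by exact_mod_cast hcard
      exact mul_le_mul_of_nonneg_right hcard' hc0
    refine (Finset.sum_le_sum this).trans (le_of_eq ?_)
    rw [Finset.sum_const, nsmul_eq_mul, ← ENNReal.ofReal_natCast A.card,
      ← ENNReal.ofReal_mul (by positivity)]

end GaussianSample

/-! ### Numerical estimates and conclusion. -/

lemma one_sub_pow_le_inv {p : ℝ} (hp0 : 0 < p) (hp1 : p ≤ 1) {m : ℕ} (hm : 0 < m) :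
    (1 - p) ^ m ≤ 1 / (p * m) := by
  have hm' : (0 : ℝ) < m := by exact_mod_cast hm
  calc (1 - p) ^ m ≤ Real.exp (-p) ^ m := by
        have := Real.add_one_le_exp (-p)
        exact pow_le_pow_left₀ (by linarith) (by linarith) m
    _ = (Real.exp (p * m))⁻¹ := by rw [← Real.exp_nat_mul, ← Real.exp_neg]; congr 1; ring
    _ ≤ (p * m)⁻¹ := by
        refine inv_anti₀ (by positivity) ?_
        linarith [Real.add_one_le_exp (p * m)]
    _ = 1 / (p * m) := (one_div _).symm

/-- With `T = N^(-3/16)` the three terms are at most `T`, `36T` and `4T`, and `41T ≤ N^(-1/16)` for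
large `N`. The constant `1/1024` turns `64D/N` into at most `L/16`. -/
lemma failure_bound_le {N D L δ : ℝ} (hN : N = Real.exp L) (hL : 1000 ≤ L) (hD1 : 60 * N ≤ D)
    (hD2 : D ≤ 1 / 1024 * N * L) (hδ : Real.exp (-(L / 16)) ≤ δ) {m : ℕ}
    (hm1 : (m : ℝ) ≤ Real.exp (L / 4)) (hm2 : Real.exp (L / 4) / 2 ≤ m) :
    Real.exp (-(1 / 2) * D) + (1 - Real.exp (-(64 * D / N + 1)) / 6) ^ m +
      m * (m * (4 / (D - N - 2))) ≤ δ := by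
  have hN0 : 0 < N := hN ▸ Real.exp_pos L
  have hLN : L + 1 ≤ N := hN ▸ Real.add_one_le_exp L
  set T := Real.exp (-(3 * L / 16)) with hT
  have hT0 : 0 < T := Real.exp_pos _
  have hm0 : (0 : ℝ) < m := lt_of_lt_of_le (by positivity) hm2
  have h1 : Real.exp (-(1 / 2) * D) ≤ T := Real.exp_le_exp.2 (by linarith)
  have h2 : (1 - Real.exp (-(64 * D / N + 1)) / 6) ^ m ≤ 36 * T := by
    set p := Real.exp (-(64 * D / N + 1)) / 6 with hp
    have hp0 : 0 < p := by positivity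
    have hDN : 64 * D / N ≤ L / 16 := by
      rw [div_le_iff₀ hN0]; linarith
    have hDN0 : 0 ≤ 64 * D / N := div_nonneg (by linarith) hN0.le
    have hp1 : p ≤ 1 := by
      have : Real.exp (-(64 * D / N + 1)) ≤ 1 := by
        rw [Real.exp_le_one_iff]; linarith
      linarith
    refine (one_sub_pow_le_inv hp0 hp1 (by exact_mod_cast hm0)).trans ?_
    rw [div_le_iff₀ (by positivity)]
    have hpl : Real.exp (-(L / 16)) / 18 ≤ p := by
      have : Real.exp (-(L / 16)) * Real.exp (-1) ≤ Real.exp (-(64 * D / N + 1)) := by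
        rw [← Real.exp_add]; exact Real.exp_le_exp.2 (by linarith)
      have he : 1 / 3 ≤ Real.exp (-1) := by
        rw [Real.exp_neg, one_div]
        exact inv_anti₀ (Real.exp_pos _) (by linarith [Real.exp_one_lt_d9])
      have h3 := mul_le_mul_of_nonneg_left he (Real.exp_pos (-(L / 16))).le
      linarith
    calc (1 : ℝ) = 36 * T * (Real.exp (-(L / 16)) / 18 * (Real.exp (L / 4) / 2)) := by
          have : T * (Real.exp (-(L / 16)) * Real.exp (L / 4)) = 1 := by
            rw [hT, ← Real.exp_add, ← Real.exp_add, ← Real.exp_zero]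
            congr 1; ring
          linarith
      _ ≤ 36 * T * (p * m) := by gcongr
  have h3 : m * (m * (4 / (D - N - 2))) ≤ 4 * T := by
    have h4 : 4 / (D - N - 2) ≤ 4 / N :=
      div_le_div_of_nonneg_left (by norm_num) hN0 (by linarith)
    calc m * (m * (4 / (D - N - 2))) ≤ Real.exp (L / 4) * (Real.exp (L / 4) * (4 / N)) := by
          have : 0 ≤ 4 / (D - N - 2) := div_nonneg (by norm_num) (by linarith)
          gcongr
      _ = 4 * Real.exp (-(L / 2)) := by
          rw [hN, div_eq_mul_inv 4 (Real.exp L), ← Real.exp_neg]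
          have : Real.exp (L / 4) * Real.exp (L / 4) * Real.exp (-L) = Real.exp (-(L / 2)) := by
            rw [← Real.exp_add, ← Real.exp_add]; congr 1; ring
          linarith
      _ ≤ 4 * T := by
          have := Real.exp_le_exp.2 (show -(L / 2) ≤ -(3 * L / 16) by linarith)
          linarith
  have h5 : 41 * T ≤ Real.exp (-(L / 16)) := by
    have : Real.exp (-(L / 16)) = Real.exp (L / 8) * T := by
      rw [hT, ← Real.exp_add]; congr 1; ring
    rw [this]
    gcongr
    linarith [Real.add_one_le_exp (L / 8)]
  linarith

/-- Lower bound on the threshold for support vector proliferation when the labels are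
`y i = sign ⟪v, x i⟫` for a fixed unit vector `v` and the `x i` are i.i.d. standard Gaussian
vectors in `ℝᵈ`. -/
theorem theoremB5 :
    ∃ C₁ C₂ C₃ : ℝ, 0 < C₁ ∧ 0 < C₂ ∧ 0 < C₃ ∧
      ∀ (n d : ℕ) (v : EuclideanSpace ℝ (Fin d)), ‖v‖ = 1 →
      ∀ δ : ℝ, 0 < δ → δ < 1 / 2 →
        C₁ * (Real.log (1 / δ)) ^ 2 ≤ (n : ℝ) →
        (d : ℝ) ≤ C₂ * (n : ℝ) * Real.log (n : ℝ) →
        C₃ * (n : ℝ) * Real.log (1 / δ) ≤ (d : ℝ) →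
      ∀ (Ω : Type*) [MeasurableSpace Ω] (μ : Measure Ω) [IsProbabilityMeasure μ]
        (x : Fin n → Ω → EuclideanSpace ℝ (Fin d)),
        (∀ i, HasLaw (x i) (stdGaussian (EuclideanSpace ℝ (Fin d))) μ) →
        iIndepFun x μ →
        μ {ω | SVPOccurs (fun i => x i ω) (fun i => Real.sign ⟪v, x i ω⟫)} ≤
          ENNReal.ofReal δ := by
  refine ⟨1, 1 / 1024, 100, by norm_num, by norm_num, by norm_num, ?_⟩
  intro n d v hv δ hδ0 hδ1 hn hd1 hd2 Ω _ μ _ x hlaw hind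
  have hv0 : v ≠ 0 := by rintro rfl; simp at hv
  set L := Real.log n with hL
  set l := Real.log (1 / δ) with hl
  have hl2 : 0.69 ≤ l := by
    have h1 : Real.log 2 ≤ l := Real.log_le_log (by norm_num) (by
      rw [le_div_iff₀ hδ0]; linarith)
    linarith [Real.log_two_gt_d9]
  have hn0 : (0 : ℝ) < n := lt_of_lt_of_le (by positivity) hn
  -- Comparing the lower and upper bounds on `d`; `102400 = 100 * 1024`. Since `l` is bounded below,
  -- this also makes `n` huge.
  have hlL : 102400 * l ≤ L := by
    have h1 : (n : ℝ) * (102400 * l) ≤ n * L := by linarith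
    exact le_of_mul_le_mul_left h1 hn0
  have hL1 : 1000 ≤ L := by linarith
  have hN : (n : ℝ) = Real.exp L := (Real.exp_log hn0).symm
  have hD1 : 60 * (n : ℝ) ≤ d := by nlinarith
  have hδL : Real.exp (-(L / 16)) ≤ δ := by
    have : δ = Real.exp (-l) := by
      rw [hl, one_div, Real.log_inv, neg_neg, Real.exp_log hδ0]
    rw [this]
    exact Real.exp_le_exp.2 (by linarith)
  have hLn : L + 1 ≤ n := hN ▸ Real.add_one_le_exp L
  set m := ⌊Real.exp (L / 4)⌋₊ with hm
  have hm1 : (m : ℝ) ≤ Real.exp (L / 4) := Nat.floor_le (Real.exp_pos _).le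
  have hm2 : Real.exp (L / 4) / 2 ≤ m := by
    have h1 := Nat.lt_floor_add_one (Real.exp (L / 4))
    have h2 := Real.add_one_le_exp (L / 4)
    rw [← hm] at h1
    linarith
  have hmn : 2 * m ≤ n := by
    have h1 : 2 * Real.exp (L / 4) ≤ n := by
      rw [hN, show L = L / 4 + 3 * L / 4 by ring, Real.exp_add, mul_comm,
        show (L / 4 + 3 * L / 4) / 4 = L / 4 by ring]
      gcongr
      linarith [Real.add_one_le_exp (3 * L / 4)]
    have h2 : 2 * (m : ℝ) ≤ n := by linarith
    exact_mod_cast h2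
  obtain ⟨A, -, hAcard⟩ := Finset.exists_subset_card_eq (s := (Finset.univ : Finset (Fin n)))
    (n := m) (by rw [Finset.card_univ, Fintype.card_fin]; omega)
  have hn0' : 0 < n := by exact_mod_cast hn0
  have hAc : Aᶜ.card = n - m := by rw [Finset.card_compl, hAcard, Fintype.card_fin]
  have hfin : Module.finrank ℝ (EuclideanSpace ℝ (Fin d)) = d := finrank_euclideanSpace_fin
  have hmain := gaussianSample_forall_inner_maxMargin_erase_le hv A (by omega)
    (by rw [Fintype.card_fin]; omega) (by rw [hfin, Fintype.card_fin]; linarith)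
  rw [hfin, Fintype.card_fin, hAcard] at hmain
  have hfail := hmain.trans (ENNReal.ofReal_le_ofReal
    (failure_bound_le hN hL1 hD1 hd1 hδL hm1 hm2))
  set X : Ω → Fin n → EuclideanSpace ℝ (Fin d) := fun ω i => x i ω with hX
  have hXm : AEMeasurable X μ := aemeasurable_pi_lambda _ fun i => (hlaw i).aemeasurable
  have hXlaw : μ.map X = gaussianSample (Fin n) (EuclideanSpace ℝ (Fin d)) := by
    rw [hX, (iIndepFun_iff_map_fun_eq_pi_map fun i => (hlaw i).aemeasurable).1 hind]
    congr 1
    ext1 i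
    exact (hlaw i).map_eq
  have hae : ∀ᵐ ω ∂μ, ∀ i, ⟪v, X ω i⟫ ≠ 0 := by
    refine ae_of_ae_map (p := fun z => ∀ i, ⟪v, z i⟫ ≠ 0) hXm ?_
    rw [hXlaw]
    exact ae_inner_ne_zero hv0
  set Z : Set (Fin n → EuclideanSpace ℝ (Fin d)) := {x | (∀ i, ⟪v, x i⟫ ≠ 0) ∧
    ∀ i, ⟪maxMargin v (Finset.univ.erase i) x, signed v (x i)⟫ ≤ 1} with hZ
  calc μ {ω | SVPOccurs (fun i => x i ω) (fun i => Real.sign ⟪v, x i ω⟫)}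
      ≤ μ (X ⁻¹' Z) := by
        refine measure_mono_ae ?_
        filter_upwards [hae] with ω hω hsvp
        exact ⟨hω, fun i => SVPOccurs.inner_maxMargin_erase_le hω hsvp i⟩
    -- This inequality holds for arbitrary sets, so `Z` need not be measurable.
    _ ≤ μ.map X Z := Measure.le_map_apply hXm Z
    _ ≤ ENNReal.ofReal δ := by rw [hXlaw]; exact hfail
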